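/- There is a universal constant $C>0$ such that the following holds. **Setting.** Let $G=(V,E)$ be a finite simple graph, $n=|V|$, with edge activities $\beta_e,\gamma_e>0$ satisfying $\beta_e\gamma_e\ge 1$ for all $e\in E$, and external fields $\lambda_v>0$ for $v\in V$. Let $\mu$ be the Gibbs distribution of this ferromagnetic two-spin system on $\Omega=\{0,1\}^V$, $$\mu(\sigma)\propto\prod_{v:\sigma_v=0}\lambda_v\prod_{e=\{u,w\}\in E:\,\sigma_u=\sigma_w=0}\beta_e\prod_{e=\{u,w\}\in E:\,\sigma_u=\sigma_w=1}\gamma_e .$$ Let $\mathcal B=(B_1,\dots,B_r)$ be blocks with $\bigcup_i B_i=V$. For $B\subseteq V$, a block update on $B$ keeps $X(V\setminus B)$ and resamples $X(B)$ from $\mu$ conditional on $X(V\setminus B)$. Let $P$ be the transition matrix of either the heat-bath block dynamics (each step updates one $B_i$, with $i$ uniform in $\{1,\dots,r\}$) or the systematic scan block dynamics (each step updates $B_1,B_2,\dots,B_r$ in this order). For $S\subseteq V$, the censored dynamics $P_S$ is defined in the same way with every $B_i$ replaced by $B_i\cap S$. For a transition matrix $Q$, a target distribution $\pi$, a set $I$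 of initial states and $\epsilon>0$, the mixing time is $\max_{x\in I}\min\{t\ge 0: d_{\mathrm{TV}}(Q^t(x,\cdot),\pi)<\epsilon\}$. The mixing time $t^P_{\mathrm{mix}}(\epsilon)$ of $P$ is the one with target $\mu$ and $I=\Omega$. Order $\Omega$ coordinatewise. Let $f:\Omega\times[0,1]^{n+1}\to\Omega$ be a monotone grand coupling of $P$: $f(\sigma,\cdot)$ is measurable and, for uniform $r\in[0,1]^{n+1}$, $f(\sigma,r)$ has law $P(\sigma,\cdot)$ for every $\sigma$, and $f(\sigma,r)\preceq f(\sigma',r)$ almost surely whenever $\sigma\preceq\sigma'$. Let $r_1,r_2,\dots$ be independent and uniform in $[0,1]^{n+1}$, let $X_0^+$ be the all-ones and $X_0^-$ the all-zeros configuration, and let $X^\pm_t=f(X^\pm_{t-1},r_t)$. For $S\subseteq V$ let $\partial S$ be the set of vertices outside $S$ with a neighbour in $S$. Let $T_{\mathrm{local}},T_{\mathrm{burn\text{-}in}}>0$ be integers. **Assumptions.** For every $v\in V$ there are $S_v\subseteq V$ with $v\in S_v$ and $\Omega_{\partial S_v}\subseteq\{0,1\}^{\partial S_v}$ such that: 1.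 (Closed under shortest paths.) For all $\sigma,\tau\in\Omega_{\partial S_v}$ at Hamming distance $t$ there are $\eta_0=\sigma,\eta_1,\dots,\eta_t=\tau$ in $\Omega_{\partial S_v}$ such that $\eta_i$ and $\eta_{i+1}$ differ at exactly one vertex for each $0\le i<t$. 2. (Aggregate strong spatial mixing under good boundary conditions.) With $a_u=\max_{\sigma\in\Omega_{\partial S_v}}d_{\mathrm{TV}}\big(\mu_v^{\sigma^{u\leftarrow0}},\mu_v^{\sigma^{u\leftarrow1}}\big)$ for $u\in\partial S_v$, one has $\sum_{u\in\partial S_v}a_u\le\frac1{20}$. Here $\mu_v^{\tau}$ is the law of $X_v$ for $X\sim\mu$ conditional on $X(\partial S_v)=\tau$, and $\sigma^{u\leftarrow c}$ is $\sigma$ with the value at $u$ changed to $c$. 3. (Local mixing.) For every $\sigma\in\{0,1\}^{V\setminus S_v}$, the censored dynamics $P_{S_v}$, started from configurations equal to $\sigma$ on $V\setminus S_v$, with target $\mu$ conditional on $X(V\setminus S_v)=\sigma$, has mixing time at most $T_{\mathrm{local}}$ at $\epsilon=\frac1{4e}$. 4. (Burn-in.) For every $t\ge T_{\mathrm{burn\text{-}in}}$,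 $\Pr\big[X_t^+(\partial S_v)\notin\Omega_{\partial S_v}\ \text{or}\ X_t^-(\partial S_v)\notin\Omega_{\partial S_v}\big]\le\frac1{n^3}$. Write $R_v=S_v\cup\partial S_v$, and assume $|R_v|\ge2$ for at least one $v$ (this holds, for example, as soon as $E\neq\emptyset$). **Conclusion.** The mixing time of $P$ is finite and $$t^P_{\mathrm{mix}}\Big(\frac1{4e}\Big)\le C\Big(T_{\mathrm{burn\text{-}in}}+T_{\mathrm{local}}\cdot\max_{v\in V}\log|R_v|\cdot\log n\Big).$$ -/

import Mathlib

open MeasureTheory Finset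

noncomputable section

namespace TwoSpin

/-- Configurations `{0,1}^V`; `false` is the spin `0` and `true` is the spin `1`.
The pointwise order on `V → Bool` is the usual partial order on configurations. -/
abbrev Config (V : Type*) := V → Bool

/-- Total variation distance of two mass functions on a finite set. -/
def tv {α : Type*} [Fintype α] (p q : α → ℝ) : ℝ := (1 / 2) * ∑ x, |p x - q x|

/-- A two-spin system on a finite simple graph, with positive edge activities and positive
external fields. -/
structure System (V : Type*) where
  graph : SimpleGraph V
  β : Sym2 V → ℝ
  γ : Sym2 V → ℝ
  lam : V → ℝ
  β_pos : ∀ e ∈ graph.edgeSet, 0 < β e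
  γ_pos : ∀ e ∈ graph.edgeSet, 0 < γ e
  lam_pos : ∀ v, 0 < lam v

/-- Ferromagnetic: `β_e γ_e ≥ 1` on every edge. -/
def System.Ferromagnetic {V : Type*} (M : System V) : Prop :=
  ∀ e ∈ M.graph.edgeSet, 1 ≤ M.β e * M.γ e

variable {V : Type*} [Fintype V] [DecidableEq V]

open Classical in
/-- The unnormalised weight of a configuration. -/
def System.weight (M : System V) (σ : Config V) : ℝ :=
  (∏ v with σ v = false, M.lam v) *
    (∏ e ∈ M.graph.edgeFinset with ∀ u ∈ e, σ u = false, M.β e) *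
    (∏ e ∈ M.graph.edgeFinset with ∀ u ∈ e, σ u = true, M.γ e)

/-- The Gibbs distribution, as a mass function on configurations. -/
def System.gibbs (M : System V) (σ : Config V) : ℝ :=
  M.weight σ / ∑ τ, M.weight τ

/-- `cond μ A σ` is the law `μ^σ` of `X ∼ μ` conditional on `X(A) = σ`. -/
def cond (μ : Config V → ℝ) (A : Finset V) (σ : A → Bool) (τ : Config V) : ℝ :=
  if A.restrict τ = σ then μ τ / ∑ ρ with A.restrict ρ = σ, μ ρ else 0

/-- The marginal law at the vertex `v`. -/
def marginal (μ : Config V → ℝ) (v : V) (c : Bool) : ℝ := ∑ τ with τ v = c, μ τ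

/-- The transition matrix `P_B` that keeps `X(V \ B)` and resamples `X(B)` from `μ` conditional
on `X(V \ B)`. Rows are indexed by the current state. -/
def blockUpdate (μ : Config V → ℝ) (B : Finset V) : Matrix (Config V) (Config V) ℝ :=
  fun σ τ => cond μ Bᶜ (Bᶜ.restrict σ) τ

/-- The two kinds of block dynamics. -/
inductive Rule
  | heatBath
  | systematicScan

/-- One step of the block dynamics with blocks `B 0, …, B (r - 1)`: either a uniformly random
block is updated, or all blocks are updated in order. Rows are indexed by the current state, so
in the matrix product the leftmost factor (the first block) acts first. -/
def blockDynamics (k : Rule) (μ : Config V → ℝ) {r : ℕ} (B : Fin r → Finset V) :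
    Matrix (Config V) (Config V) ℝ :=
  match k with
  | .heatBath => (1 / (r : ℝ)) • ∑ i, blockUpdate μ (B i)
  | .systematicScan => (List.ofFn fun i => blockUpdate μ (B i)).prod

/-- The censored block dynamics: each block `B i` is replaced by `B i ∩ S`. -/
def censored (k : Rule) (μ : Config V → ℝ) {r : ℕ} (B : Fin r → Finset V) (S : Finset V) :
    Matrix (Config V) (Config V) ℝ :=
  blockDynamics k μ fun i => B i ∩ S

/-- Mixing time to `π`, over the initial states in `I`: the maximum over the initial states of the
first time at which the distance to `π` is less than `ε`. It is `⊤` if some initial state has no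
such time. -/
def mixingTime (P : Matrix (Config V) (Config V) ℝ) (π : Config V → ℝ) (I : Set (Config V))
    (ε : ℝ) : ℕ∞ :=
  ⨆ x ∈ I, ⨅ t ∈ {t : ℕ | tv ((P ^ t) x) π < ε}, (t : ℕ∞)

open Classical in
/-- The outer boundary of `S` in the graph `G`. -/
def outerBoundary (G : SimpleGraph V) (S : Finset V) : Finset V :=
  {v | v ∉ S ∧ ∃ u ∈ S, G.Adj u v}

/-- The influence of `u ∈ ∂S` on `v` under the boundary conditions in `Good`. -/
def influence (μ : Config V → ℝ) (v : V) (D : Finset V) (Good : Set (D → Bool)) (u : D) : ℝ :=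
  ⨆ σ : Good, tv (marginal (cond μ D (Function.update σ.1 u false)) v)
    (marginal (cond μ D (Function.update σ.1 u true)) v)

/-- The neighbourhood `S` of `v` and the set `Good` of boundary conditions are good with local
mixing time `Tloc`. -/
structure IsGood (M : System V) (k : Rule) {r : ℕ} (B : Fin r → Finset V) (v : V) (S : Finset V)
    (Good : Set (outerBoundary M.graph S → Bool)) (Tloc : ℕ) : Prop where
  mem : v ∈ S
  closed_under_shortest_paths : ∀ σ ∈ Good, ∀ τ ∈ Good,
    ∃ η : ℕ → (outerBoundary M.graph S → Bool), η 0 = σ ∧ η (hammingDist σ τ) = τ ∧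
      (∀ i ≤ hammingDist σ τ, η i ∈ Good) ∧
      ∀ i < hammingDist σ τ, hammingDist (η i) (η (i + 1)) = 1
  assm : ∑ u, influence M.gibbs v (outerBoundary M.graph S) Good u ≤ 1 / 20
  local_mixing : ∀ σ : (Sᶜ : Finset V) → Bool,
    mixingTime (censored k M.gibbs B S) (cond M.gibbs Sᶜ σ) {x | Sᶜ.restrict x = σ}
      (1 / (4 * Real.exp 1)) ≤ Tloc

/-- The cube `[0,1]^(n+1)`, `n = |V|`; its `volume` is the uniform probability measure. -/
abbrev Cube (V : Type*) [Fintype V] := Fin (Fintype.card V + 1) → unitInterval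

/-- `f` is a monotone grand coupling of the chain `P`: for uniform `r`, `f σ r` has law
`P(σ, ·)`, and `σ ≤ σ'` implies `f σ r ≤ f σ' r` almost surely. -/
structure IsMonotoneCoupling (P : Matrix (Config V) (Config V) ℝ)
    (f : Config V → Cube V → Config V) : Prop where
  measurable : ∀ σ, Measurable (f σ)
  law : ∀ σ τ, (volume : Measure (Cube V)).real {r | f σ r = τ} = P σ τ
  monotone : ∀ σ σ', σ ≤ σ' → ∀ᵐ r ∂(volume : Measure (Cube V)), f σ r ≤ f σ' r

/-- The chain driven by `f`, the randomness `ω` and the initial state `x`: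
`X_0 = x` and `X_(t+1) = f (X_t, ω_t)`. -/
def chain (f : Config V → Cube V → Config V) (x : Config V) (ω : ℕ → Cube V) : ℕ → Config V
  | 0 => x
  | t + 1 => f (chain f x ω t) (ω t)

/-- The law of a sequence of independent uniform elements of the cube. -/
def seqLaw (V : Type*) [Fintype V] : Measure (ℕ → Cube V) :=
  Measure.infinitePi fun _ => (volume : Measure (Cube V))

end TwoSpin

end

set_option linter.unusedSectionVars false

/-! Follow, for each vertex `v`, the number `gap P t v`. Under the monotone grand coupling it is the
probability that the all-ones and all-zeros chains disagree at `v` at time `t`. Every other chain is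
sandwiched between these two, so the sum of the gaps over `v` bounds the distance between any two
rows of `P ^ t` (`tv_pow_le_sum`). It therefore suffices to make every gap of order `n⁻³`.

The gaps satisfy a recursion (`IsGood.gap_add_le`). Run `P` up to a time `t` after burn-in, then run
`Tloc * K` further steps. Replacing these further steps by the dynamics censored to `S v` can only
enlarge the gap at `v` (`CorrLE.gap_le`). Ferromagnetism gives the FKG lattice condition, and with
Holley and FKG one gets the censoring inequality for one block (`blockUpdate_censoring`). It passes
to products and averages as a comparison of correlations of increasing functions.

The censored dynamics is easy to analyse. It depends only on the state in `R = S v ∪ ∂(S v)`, and it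
approaches equilibrium on `S v` at rate `e⁻ᴷ`. Three errors arise at time `t`: a bad boundary has
probability at most `n⁻³`; incomplete local mixing costs at most `2 e⁻ᴷ` for each disagreement in
`R`; and a disagreement at `u ∈ ∂(S v)` costs the influence of `u`. With `K` of order `log |R|` the
last two together contribute at most one tenth of the largest gap at time `t`. Order `log n` rounds
then suffice, and submultiplicativity over three such periods reaches the required accuracy. -/

namespace TwoSpin

/-! ### The Gibbs weight: positivity, lattice condition and spatial factorisation. -/

variable {V : Type*} [Fintype V] [DecidableEq V]

/-- The factor of the weight that belongs to the vertex `v`. -/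
noncomputable def System.vertexFactor (M : System V) (v : V) (σ : Config V) : ℝ :=
  if σ v = false then M.lam v else 1

open Classical in
/-- The factor of the weight that belongs to the edge `e`. -/
noncomputable def System.edgeFactor (M : System V) (e : Sym2 V) (σ : Config V) : ℝ :=
  (if ∀ u ∈ e, σ u = false then M.β e else 1) * (if ∀ u ∈ e, σ u = true then M.γ e else 1)

open Classical in
lemma System.weight_eq_prod (M : System V) (σ : Config V) :
    M.weight σ = (∏ v, M.vertexFactor v σ) * ∏ e ∈ M.graph.edgeFinset, M.edgeFactor e σ := by
  simp only [System.weight, System.vertexFactor, System.edgeFactor, prod_mul_distrib, prod_filter,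
    mul_assoc]

lemma System.vertexFactor_pos (M : System V) (v : V) (σ : Config V) : 0 < M.vertexFactor v σ := by
  unfold System.vertexFactor
  split_ifs
  exacts [M.lam_pos v, one_pos]

lemma System.edgeFactor_pos (M : System V) {e : Sym2 V} (he : e ∈ M.graph.edgeSet)
    (σ : Config V) : 0 < M.edgeFactor e σ := by
  have h1 := M.β_pos e he
  have h2 := M.γ_pos e he
  unfold System.edgeFactor
  split_ifs <;> positivity

lemma System.weight_pos (M : System V) (σ : Config V) : 0 < M.weight σ := by
  classical
  rw [M.weight_eq_prod]
  exact mul_pos (prod_pos fun v _ => M.vertexFactor_pos v σ)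
    (prod_pos fun e he => M.edgeFactor_pos (SimpleGraph.mem_edgeFinset.1 he) σ)

lemma System.vertexFactor_mul (M : System V) (v : V) (σ τ : Config V) :
    M.vertexFactor v σ * M.vertexFactor v τ
      = M.vertexFactor v (σ ⊓ τ) * M.vertexFactor v (σ ⊔ τ) := by
  unfold System.vertexFactor
  rcases h1 : σ v <;> rcases h2 : τ v <;> simp [h1, h2]

/-- Equality holds unless the two configurations read `01` and `10` on the edge. Then the left side
is `1` and the right side is `β γ`, which is the one place where ferromagnetism enters. -/
lemma System.edgeFactor_mul_le (M : System V) (hM : M.Ferromagnetic) {e : Sym2 V}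
    (he : e ∈ M.graph.edgeSet) (σ τ : Config V) :
    M.edgeFactor e σ * M.edgeFactor e τ
      ≤ M.edgeFactor e (σ ⊓ τ) * M.edgeFactor e (σ ⊔ τ) := by
  have h := hM e he
  unfold System.edgeFactor
  induction e with
  | h u w =>
    rcases h1 : σ u <;> rcases h2 : τ u <;> rcases h3 : σ w <;> rcases h4 : τ w <;>
      simp [h1, h2, h3, h4, h, mul_comm]

lemma System.weight_mul_le (M : System V) (hM : M.Ferromagnetic) (σ τ : Config V) :
    M.weight σ * M.weight τ ≤ M.weight (σ ⊓ τ) * M.weight (σ ⊔ τ) := by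
  classical
  simp only [M.weight_eq_prod]
  rw [mul_mul_mul_comm, mul_mul_mul_comm (∏ v, M.vertexFactor v (σ ⊓ τ))]
  simp only [← prod_mul_distrib]
  rw [prod_congr rfl fun v _ => M.vertexFactor_mul v σ τ]
  refine mul_le_mul_of_nonneg_left (prod_le_prod (fun e he => ?_) fun e he => ?_)
    (prod_nonneg fun v _ => mul_nonneg (M.vertexFactor_pos _ _).le (M.vertexFactor_pos _ _).le)
  · rw [SimpleGraph.mem_edgeFinset] at he
    exact mul_nonneg (M.edgeFactor_pos he _).le (M.edgeFactor_pos he _).le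
  · exact M.edgeFactor_mul_le hM (SimpleGraph.mem_edgeFinset.1 he) σ τ

lemma System.sum_weight_pos (M : System V) : 0 < ∑ τ, M.weight τ :=
  sum_pos (fun τ _ => M.weight_pos τ) univ_nonempty

lemma System.gibbs_pos (M : System V) (σ : Config V) : 0 < M.gibbs σ :=
  div_pos (M.weight_pos σ) M.sum_weight_pos

lemma System.sum_gibbs (M : System V) : ∑ σ, M.gibbs σ = 1 := by
  simp only [System.gibbs, ← sum_div]
  exact div_self M.sum_weight_pos.ne'

lemma System.gibbs_mul_le (M : System V) (hM : M.Ferromagnetic) (σ τ : Config V) :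
    M.gibbs σ * M.gibbs τ ≤ M.gibbs (σ ⊓ τ) * M.gibbs (σ ⊔ τ) := by
  have := M.sum_weight_pos
  simp only [System.gibbs, div_mul_div_comm]
  exact div_le_div_of_nonneg_right (M.weight_mul_le hM σ τ) (by positivity)

/-- The Gibbs distribution factorises over `S ∪ ∂S` and the complement of `S`. -/
lemma System.exists_gibbs_eq_mul (M : System V) (S : Finset V) :
    ∃ a b : Config V → ℝ, (∀ σ, M.gibbs σ = a σ * b σ) ∧
      DependsOn a ((S ∪ outerBoundary M.graph S : Finset V) : Set V) ∧
      DependsOn b ((Sᶜ : Finset V) : Set V) := by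
  classical
  -- `a` collects the vertices of `S` and the edges meeting `S`, whose other endpoints lie in `S ∪
  -- ∂S`; `b` takes everything else, including the normalisation.
  refine ⟨fun σ => (∏ v ∈ S, M.vertexFactor v σ) *
      ∏ e ∈ M.graph.edgeFinset with ∃ u ∈ S, u ∈ e, M.edgeFactor e σ,
    fun σ => ((∏ v ∈ Sᶜ, M.vertexFactor v σ) *
      ∏ e ∈ M.graph.edgeFinset with ¬ ∃ u ∈ S, u ∈ e, M.edgeFactor e σ) / ∑ τ, M.weight τ,
    fun σ => ?_, fun σ τ h => ?_, fun σ τ h => ?_⟩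
  · rw [System.gibbs, M.weight_eq_prod, ← prod_mul_prod_compl S,
      ← prod_filter_mul_prod_filter_not M.graph.edgeFinset (fun e => ∃ u ∈ S, u ∈ e)]
    ring
  · dsimp only
    congr 1
    · refine prod_congr rfl fun v hv => ?_
      rw [System.vertexFactor, System.vertexFactor, h v (by simp [hv])]
    · refine prod_congr rfl fun e he => ?_
      obtain ⟨he, u, hu, hue⟩ := mem_filter.1 he
      rw [SimpleGraph.mem_edgeFinset] at he
      have key : ∀ w ∈ e, σ w = τ w := by
        intro w hw
        refine h w ?_
        rw [mem_coe, mem_union]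
        by_cases hwS : w ∈ S
        · exact Or.inl hwS
        · have huw : u ≠ w := fun hh => hwS (hh ▸ hu)
          rw [(Sym2.mem_and_mem_iff huw).1 ⟨hue, hw⟩, SimpleGraph.mem_edgeSet] at he
          exact Or.inr (by simp only [outerBoundary, mem_filter, mem_univ, true_and]
                           exact ⟨hwS, u, hu, he⟩)
      have h1 : ∀ c, (∀ u ∈ e, σ u = c) ↔ ∀ u ∈ e, τ u = c := fun c =>
        forall₂_congr fun w hw => by rw [key w hw]
      simp only [System.edgeFactor, h1]
  · dsimp only
    congr 2
    · refine prod_congr rfl fun v hv => ?_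
      rw [System.vertexFactor, System.vertexFactor, h v (by simpa using hv)]
    · refine prod_congr rfl fun e he => ?_
      obtain ⟨-, he⟩ := mem_filter.1 he
      have h1 : ∀ c, (∀ u ∈ e, σ u = c) ↔ ∀ u ∈ e, τ u = c := fun c =>
        forall₂_congr fun w hw => by
          rw [h w (by
            rw [mem_coe, mem_compl]
            exact fun hS => he ⟨w, hS, hw⟩)]
      simp only [System.edgeFactor, h1]

/-! ### Block updates -/

lemma mulVec_nonneg {K : Matrix (Config V) (Config V) ℝ} (hK : ∀ x y, 0 ≤ K x y)
    {h : Config V → ℝ} (h0 : 0 ≤ h) : 0 ≤ K.mulVec h :=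
  fun x => sum_nonneg fun y _ => mul_nonneg (hK x y) (h0 y)

section BlockUpdate

variable {μ : Config V → ℝ} (hμ : ∀ σ, 0 < μ σ)

lemma blockUpdate_apply (μ : Config V → ℝ) (B : Finset V) (x τ : Config V) :
    blockUpdate μ B x τ = if Bᶜ.restrict τ = Bᶜ.restrict x then
      μ τ / ∑ ρ with Bᶜ.restrict ρ = Bᶜ.restrict x, μ ρ else 0 := rfl

lemma restrict_eq_restrict {A : Finset V} {σ τ : Config V} :
    A.restrict σ = A.restrict τ ↔ ∀ v ∈ A, σ v = τ v := by
  simp [funext_iff]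

/-- On functions, a block update is the conditional expectation given `X(V \ B)`. The
self-adjointness, projection and tower properties below are those of conditional expectations in
`L²(μ)`. -/
lemma blockUpdate_mulVec (μ : Config V → ℝ) (B : Finset V) (h : Config V → ℝ) (x : Config V) :
    (blockUpdate μ B).mulVec h x = (∑ ρ with Bᶜ.restrict ρ = Bᶜ.restrict x, μ ρ * h ρ) /
      ∑ ρ with Bᶜ.restrict ρ = Bᶜ.restrict x, μ ρ := by
  simp only [Matrix.mulVec, dotProduct, blockUpdate_apply, sum_div, sum_filter]
  refine sum_congr rfl fun τ _ => ?_
  split_ifs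
  · ring
  · simp

include hμ

lemma fiber_sum_pos (A : Finset V) (x : Config V) :
    0 < ∑ ρ with A.restrict ρ = A.restrict x, μ ρ :=
  sum_pos (fun ρ _ => hμ ρ) ⟨x, by simp⟩

lemma blockUpdate_nonneg (B : Finset V) (x y : Config V) : 0 ≤ blockUpdate μ B x y := by
  rw [blockUpdate_apply]
  split_ifs
  exacts [div_nonneg (hμ y).le (fiber_sum_pos hμ _ _).le, le_rfl]

lemma blockUpdate_sum_row (B : Finset V) (x : Config V) : ∑ y, blockUpdate μ B x y = 1 := by
  simp only [blockUpdate_apply]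
  rw [← sum_filter, ← sum_div, div_self (fiber_sum_pos hμ _ _).ne']

lemma blockUpdate_reversible (B : Finset V) (x y : Config V) :
    μ x * blockUpdate μ B x y = μ y * blockUpdate μ B y x := by
  simp only [blockUpdate_apply]
  by_cases h : Bᶜ.restrict y = Bᶜ.restrict x
  · simp only [h, if_true]
    ring
  · rw [if_neg h, if_neg (Ne.symm h)]
    simp

lemma blockUpdate_selfAdjoint (B : Finset V) (g h : Config V → ℝ) :
    ∑ x, μ x * g x * (blockUpdate μ B).mulVec h x
      = ∑ x, μ x * (blockUpdate μ B).mulVec g x * h x := by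
  simp only [Matrix.mulVec, dotProduct, mul_sum, sum_mul]
  rw [sum_comm]
  refine sum_congr rfl fun x _ => sum_congr rfl fun y _ => ?_
  linear_combination g y * h x * blockUpdate_reversible hμ B y x

omit hμ in
lemma blockUpdate_dependsOn (B : Finset V) (h : Config V → ℝ) :
    DependsOn ((blockUpdate μ B).mulVec h) ((Bᶜ : Finset V) : Set V) := by
  intro x y hxy
  have : Bᶜ.restrict x = Bᶜ.restrict y := restrict_eq_restrict.2 hxy
  rw [blockUpdate_mulVec, blockUpdate_mulVec, this]

lemma blockUpdate_mulVec_of_dependsOn (B : Finset V) {g : Config V → ℝ}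
    (hg : DependsOn g ((Bᶜ : Finset V) : Set V)) : (blockUpdate μ B).mulVec g = g := by
  ext x
  rw [blockUpdate_mulVec, div_eq_iff (fiber_sum_pos hμ _ _).ne', mul_sum]
  refine sum_congr rfl fun ρ hρ => ?_
  rw [mul_comm, hg (restrict_eq_restrict.1 (mem_filter.1 hρ).2)]

lemma sum_mul_blockUpdate (B : Finset V) {g : Config V → ℝ}
    (hg : DependsOn g ((Bᶜ : Finset V) : Set V)) (h : Config V → ℝ) :
    ∑ x, μ x * g x * (blockUpdate μ B).mulVec h x = ∑ x, μ x * g x * h x := by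
  rw [blockUpdate_selfAdjoint hμ, blockUpdate_mulVec_of_dependsOn hμ B hg]

/-- The sum of `μ h` over a cylinder is not changed by an update outside its base. -/
lemma sum_fiber_blockUpdate {A B : Finset V} (hAB : Disjoint A B) (σ : A → Bool)
    (h : Config V → ℝ) :
    ∑ x with A.restrict x = σ, μ x * (blockUpdate μ B).mulVec h x
      = ∑ x with A.restrict x = σ, μ x * h x := by
  have := sum_mul_blockUpdate hμ B (g := fun x => if A.restrict x = σ then 1 else 0)
    (fun x y hxy => by
      have : A.restrict x = A.restrict y := restrict_eq_restrict.2 fun v hv =>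
        hxy v (by simpa using disjoint_left.1 hAB hv)
      simp only [this]) h
  simpa [sum_filter] using this

lemma blockUpdate_mulVec_blockUpdate {B B' : Finset V} (hB : B' ⊆ B) (h : Config V → ℝ) :
    (blockUpdate μ B).mulVec ((blockUpdate μ B').mulVec h) = (blockUpdate μ B).mulVec h := by
  ext x
  rw [blockUpdate_mulVec, blockUpdate_mulVec,
    sum_fiber_blockUpdate hμ (disjoint_compl_left.mono_right hB)]

variable (hlat : ∀ σ τ, μ σ * μ τ ≤ μ (σ ⊓ τ) * μ (σ ⊔ τ))

include hlat

/-- Since `x ≤ y`, the meet of `a` and `b` agrees with `x` outside `B` and the join agrees with `y`.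
So both sides carry the same normalisations, and the lattice condition for `μ` remains. -/
lemma blockUpdate_mul_le (B : Finset V) {x y : Config V} (hxy : x ≤ y) (a b : Config V) :
    blockUpdate μ B x a * blockUpdate μ B y b
      ≤ blockUpdate μ B x (a ⊓ b) * blockUpdate μ B y (a ⊔ b) := by
  by_cases ha : Bᶜ.restrict a = Bᶜ.restrict x
  · by_cases hb : Bᶜ.restrict b = Bᶜ.restrict y
    · have h1 : Bᶜ.restrict (a ⊓ b) = Bᶜ.restrict x := by
        rw [restrict_eq_restrict] at *
        intro v hv
        rw [Pi.inf_apply, ha v hv, hb v hv]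
        exact inf_eq_left.2 (hxy v)
      have h2 : Bᶜ.restrict (a ⊔ b) = Bᶜ.restrict y := by
        rw [restrict_eq_restrict] at *
        intro v hv
        rw [Pi.sup_apply, ha v hv, hb v hv]
        exact sup_eq_right.2 (hxy v)
      simp only [blockUpdate_apply, ha, hb, h1, h2, if_true, div_mul_div_comm]
      exact div_le_div_of_nonneg_right (hlat a b)
        (mul_pos (fiber_sum_pos hμ _ _) (fiber_sum_pos hμ _ _)).le
    · rw [blockUpdate_apply μ B y b, if_neg hb, mul_zero]
      exact mul_nonneg (blockUpdate_nonneg hμ _ _ _) (blockUpdate_nonneg hμ _ _ _)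
  · rw [blockUpdate_apply μ B x a, if_neg ha, zero_mul]
    exact mul_nonneg (blockUpdate_nonneg hμ _ _ _) (blockUpdate_nonneg hμ _ _ _)

/-- Holley's inequality for the rows at `x` and `y`. It is applied in its form for nonnegative
functions, hence the sign conditions on test functions throughout. -/
lemma blockUpdate_monotone (B : Finset V) {h : Config V → ℝ} (h0 : 0 ≤ h) (hm : Monotone h) :
    Monotone ((blockUpdate μ B).mulVec h) := by
  intro x y hxy
  have := holley (μ := h) (f := blockUpdate μ B x) (g := blockUpdate μ B y) h0
    (fun z => blockUpdate_nonneg hμ B x z) (fun z => blockUpdate_nonneg hμ B y z) hm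
    (by rw [blockUpdate_sum_row hμ, blockUpdate_sum_row hμ]) (blockUpdate_mul_le hμ hlat B hxy)
  simpa only [Matrix.mulVec, dotProduct, mul_comm] using this

lemma blockUpdate_mul_le_mulVec (B : Finset V) {g h : Config V → ℝ} (g0 : 0 ≤ g) (h0 : 0 ≤ h)
    (hg : Monotone g) (hh : Monotone h) (x : Config V) :
    (blockUpdate μ B).mulVec g x * (blockUpdate μ B).mulVec h x
      ≤ (blockUpdate μ B).mulVec (fun y => g y * h y) x := by
  have := fkg (μ := blockUpdate μ B x) (f := g) (g := h) (fun z => blockUpdate_nonneg hμ B x z) g0 h0 hg hh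
    (blockUpdate_mul_le hμ hlat B le_rfl)
  rw [blockUpdate_sum_row hμ, one_mul] at this
  exact this

/-- Updating a smaller block leaves increasing functions more correlated. -/
lemma blockUpdate_censoring {B B' : Finset V} (hB : B' ⊆ B) {g h : Config V → ℝ} (g0 : 0 ≤ g)
    (h0 : 0 ≤ h) (hg : Monotone g) (hh : Monotone h) :
    ∑ x, μ x * g x * (blockUpdate μ B).mulVec h x
      ≤ ∑ x, μ x * g x * (blockUpdate μ B').mulVec h x := by
  set h' := (blockUpdate μ B').mulVec h with hh'
  have h0' : 0 ≤ h' := mulVec_nonneg (blockUpdate_nonneg hμ B') h0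
  have hm' : Monotone h' := blockUpdate_monotone hμ hlat B' h0 hh
  -- With `E_B` the conditional expectation, `E_B = E_B E_B E_{B'}`. Move one `E_B` onto `g`, apply
  -- FKG inside each fibre of `E_B`, and drop the outer `E_B` by stationarity.
  calc ∑ x, μ x * g x * (blockUpdate μ B).mulVec h x
      = ∑ x, μ x * g x * (blockUpdate μ B).mulVec ((blockUpdate μ B).mulVec h') x := by
        rw [blockUpdate_mulVec_blockUpdate hμ Subset.rfl, hh',
          blockUpdate_mulVec_blockUpdate hμ hB]
    _ = ∑ x, μ x * ((blockUpdate μ B).mulVec g x * (blockUpdate μ B).mulVec h' x) := by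
        rw [blockUpdate_selfAdjoint hμ]
        simp only [mul_assoc]
    _ ≤ ∑ x, μ x * (blockUpdate μ B).mulVec (fun y => g y * h' y) x :=
        sum_le_sum fun x _ => mul_le_mul_of_nonneg_left
          (blockUpdate_mul_le_mulVec hμ hlat B g0 h0' hg hm' x) (hμ x).le
    _ = ∑ x, μ x * g x * h' x := by
        have := sum_mul_blockUpdate hμ B (g := fun _ => 1) (fun _ _ _ => rfl)
          (fun y => g y * h' y)
        simpa [mul_assoc] using this

end BlockUpdate

/-! ### Monotone kernels and censoring -/

/-- A stochastic matrix with stationary mass function `μ` such that it and an adjoint of it in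
`L²(μ)` preserve nonnegative increasing functions. -/
structure IsMonotoneKernel (μ : Config V → ℝ) (K : Matrix (Config V) (Config V) ℝ) : Prop where
  nonneg : ∀ x y, 0 ≤ K x y
  sum_row : ∀ x, ∑ y, K x y = 1
  stationary : ∀ h, ∑ x, μ x * K.mulVec h x = ∑ x, μ x * h x
  monotone : ∀ h, 0 ≤ h → Monotone h → Monotone (K.mulVec h)
  -- Systematic scan need not be reversible, so the adjoint is a separate matrix: for a product it
  -- is the product of the adjoints in reverse order.
  adjoint : ∃ K' : Matrix (Config V) (Config V) ℝ, (∀ x y, 0 ≤ K' x y) ∧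
    (∀ h, 0 ≤ h → Monotone h → Monotone (K'.mulVec h)) ∧
    ∀ g h, ∑ x, μ x * g x * K.mulVec h x = ∑ x, μ x * K'.mulVec g x * h x

/-- The conclusion of the censoring inequality: `K'` leaves increasing functions at least as
correlated as `K`. -/
def CorrLE (μ : Config V → ℝ) (K K' : Matrix (Config V) (Config V) ℝ) : Prop :=
  ∀ g h, 0 ≤ g → 0 ≤ h → Monotone g → Monotone h →
    ∑ x, μ x * g x * K.mulVec h x ≤ ∑ x, μ x * g x * K'.mulVec h x

lemma blockUpdate_isMonotoneKernel {μ : Config V → ℝ} (hμ : ∀ σ, 0 < μ σ)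
    (hlat : ∀ σ τ, μ σ * μ τ ≤ μ (σ ⊓ τ) * μ (σ ⊔ τ)) (B : Finset V) :
    IsMonotoneKernel μ (blockUpdate μ B) where
  nonneg := blockUpdate_nonneg hμ B
  sum_row := blockUpdate_sum_row hμ B
  stationary h := by
    simpa using sum_mul_blockUpdate hμ B (g := fun _ => 1) (fun _ _ _ => rfl) h
  monotone _ := blockUpdate_monotone hμ hlat B
  adjoint := ⟨_, blockUpdate_nonneg hμ B, fun _ => blockUpdate_monotone hμ hlat B,
    blockUpdate_selfAdjoint hμ B⟩

lemma average_mulVec {r : ℕ} (K : Fin r → Matrix (Config V) (Config V) ℝ) (h : Config V → ℝ)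
    (x : Config V) :
    ((1 / (r : ℝ)) • ∑ i, K i).mulVec h x = 1 / (r : ℝ) * ∑ i, (K i).mulVec h x := by
  rw [Matrix.smul_mulVec, Matrix.sum_mulVec]
  simp

lemma average_apply {r : ℕ} (K : Fin r → Matrix (Config V) (Config V) ℝ) (x y : Config V) :
    ((1 / (r : ℝ)) • ∑ i, K i) x y = 1 / (r : ℝ) * ∑ i, K i x y := by
  simp [Matrix.sum_apply]

lemma sum_average {r : ℕ} (K : Fin r → Matrix (Config V) (Config V) ℝ) (g h : Config V → ℝ) :
    ∑ x, g x * ((1 / (r : ℝ)) • ∑ i, K i).mulVec h x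
      = 1 / (r : ℝ) * ∑ i, ∑ x, g x * (K i).mulVec h x := by
  simp only [average_mulVec, mul_sum]
  rw [sum_comm]
  exact sum_congr rfl fun i _ => sum_congr rfl fun x _ => by ring

namespace IsMonotoneKernel

variable {μ : Config V → ℝ}

lemma one : IsMonotoneKernel μ (1 : Matrix (Config V) (Config V) ℝ) where
  nonneg x y := by
    rw [Matrix.one_apply]
    split_ifs <;> norm_num
  sum_row x := by simp [Matrix.one_apply]
  stationary h := by simp
  monotone h _ hm := by simpa using hm
  adjoint := ⟨1, fun x y => by
    rw [Matrix.one_apply]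
    split_ifs <;> norm_num, fun h _ hm => by simpa using hm, fun g h => by simp⟩

lemma mul {K L : Matrix (Config V) (Config V) ℝ} (hK : IsMonotoneKernel μ K)
    (hL : IsMonotoneKernel μ L) : IsMonotoneKernel μ (K * L) where
  nonneg x y := by
    rw [Matrix.mul_apply]
    exact sum_nonneg fun z _ => mul_nonneg (hK.nonneg x z) (hL.nonneg z y)
  sum_row x := by
    simp only [Matrix.mul_apply]
    rw [sum_comm]
    simp only [← mul_sum, hL.sum_row, mul_one, hK.sum_row]
  stationary h := by
    simp only [← Matrix.mulVec_mulVec]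
    rw [hK.stationary, hL.stationary]
  monotone h h0 hm := by
    rw [← Matrix.mulVec_mulVec]
    exact hK.monotone _ (mulVec_nonneg hL.nonneg h0) (hL.monotone h h0 hm)
  adjoint := by
    obtain ⟨K', hK0, hKm, hKa⟩ := hK.adjoint
    obtain ⟨L', hL0, hLm, hLa⟩ := hL.adjoint
    refine ⟨L' * K', fun x y => ?_, fun h h0 hm => ?_, fun g h => ?_⟩
    · rw [Matrix.mul_apply]
      exact sum_nonneg fun z _ => mul_nonneg (hL0 x z) (hK0 z y)
    · rw [← Matrix.mulVec_mulVec]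
      exact hLm _ (mulVec_nonneg hK0 h0) (hKm h h0 hm)
    · simp only [← Matrix.mulVec_mulVec]
      rw [hKa, hLa]

lemma pow {K : Matrix (Config V) (Config V) ℝ} (hK : IsMonotoneKernel μ K) (n : ℕ) :
    IsMonotoneKernel μ (K ^ n) := by
  induction n with
  | zero => simpa using one
  | succ n ih =>
    rw [pow_succ]
    exact ih.mul hK

lemma average {r : ℕ} (hr : 0 < r) {K : Fin r → Matrix (Config V) (Config V) ℝ}
    (hK : ∀ i, IsMonotoneKernel μ (K i)) : IsMonotoneKernel μ ((1 / (r : ℝ)) • ∑ i, K i) where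
  nonneg x y := by
    rw [average_apply]
    exact mul_nonneg (by positivity) (sum_nonneg fun i _ => (hK i).nonneg x y)
  sum_row x := by
    simp only [average_apply]
    rw [← mul_sum, sum_comm]
    simp only [(hK _).sum_row]
    simp [hr.ne']
  stationary h := by
    rw [sum_average]
    simp only [(hK _).stationary]
    simp [hr.ne']
  monotone h h0 hm x y hxy := by
    rw [average_mulVec, average_mulVec]
    exact mul_le_mul_of_nonneg_left (sum_le_sum fun i _ => (hK i).monotone h h0 hm hxy)
      (by positivity)
  adjoint := by
    choose K' hK0 hKm hKa using fun i => (hK i).adjoint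
    refine ⟨(1 / (r : ℝ)) • ∑ i, K' i, fun x y => ?_, fun h h0 hm x y hxy => ?_, fun g h => ?_⟩
    · rw [average_apply]
      exact mul_nonneg (by positivity) (sum_nonneg fun i _ => hK0 i x y)
    · rw [average_mulVec, average_mulVec]
      exact mul_le_mul_of_nonneg_left (sum_le_sum fun i _ => hKm i h h0 hm hxy) (by positivity)
    · rw [sum_average]
      simp only [hKa]
      simp only [average_mulVec, mul_sum, sum_mul]
      rw [sum_comm]
      exact sum_congr rfl fun i _ => sum_congr rfl fun x _ => by ring

end IsMonotoneKernel

namespace CorrLE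

variable {μ : Config V → ℝ}

lemma refl (K : Matrix (Config V) (Config V) ℝ) : CorrLE μ K K := fun _ _ _ _ _ _ => le_rfl

/-- Replace one factor at a time. The adjoint of `K` moves to `g` and keeps it increasing, so `L`
may become `L'`; then `L' h` is increasing, so `K` may become `K'`. -/
lemma mul {K K' L L' : Matrix (Config V) (Config V) ℝ} (hK : IsMonotoneKernel μ K)
    (hL' : IsMonotoneKernel μ L') (h₁ : CorrLE μ K K') (h₂ : CorrLE μ L L') :
    CorrLE μ (K * L) (K' * L') := by
  intro g h g0 h0 hg hh
  obtain ⟨A, hA0, hAm, hA⟩ := hK.adjoint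
  simp only [← Matrix.mulVec_mulVec]
  calc _ = ∑ x, μ x * A.mulVec g x * L.mulVec h x := hA _ _
    _ ≤ ∑ x, μ x * A.mulVec g x * L'.mulVec h x :=
        h₂ _ _ (mulVec_nonneg hA0 g0) h0 (hAm _ g0 hg) hh
    _ = ∑ x, μ x * g x * K.mulVec (L'.mulVec h) x := (hA _ _).symm
    _ ≤ _ := h₁ _ _ g0 (mulVec_nonneg hL'.nonneg h0) hg (hL'.monotone _ h0 hh)

lemma pow {K K' : Matrix (Config V) (Config V) ℝ} (hK : IsMonotoneKernel μ K)
    (hK' : IsMonotoneKernel μ K') (h : CorrLE μ K K') (n : ℕ) : CorrLE μ (K ^ n) (K' ^ n) := by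
  induction n with
  | zero => exact refl _
  | succ n ih =>
    rw [pow_succ, pow_succ]
    exact mul (hK.pow n) hK' ih h

lemma average {r : ℕ} {K K' : Fin r → Matrix (Config V) (Config V) ℝ}
    (h : ∀ i, CorrLE μ (K i) (K' i)) :
    CorrLE μ ((1 / (r : ℝ)) • ∑ i, K i) ((1 / (r : ℝ)) • ∑ i, K' i) := by
  intro g f g0 f0 hg hf
  rw [sum_average, sum_average]
  exact mul_le_mul_of_nonneg_left (sum_le_sum fun i _ => h i g f g0 f0 hg hf) (by positivity)

end CorrLE

/-- A property of matrices that passes to products and averages holds for the block dynamics if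
it holds for every block update. -/
lemma blockDynamics_induction {μ : Config V → ℝ} {r : ℕ} (B : Fin r → Finset V)
    (k : Rule) (p : Matrix (Config V) (Config V) ℝ → Prop) (h1 : p 1)
    (hmul : ∀ K L, p K → p L → p (K * L))
    (havg : ∀ K : Fin r → Matrix (Config V) (Config V) ℝ, (∀ i, p (K i)) →
      p ((1 / (r : ℝ)) • ∑ i, K i))
    (hB : ∀ i, p (blockUpdate μ (B i))) : p (blockDynamics k μ B) := by
  cases k with
  | heatBath => exact havg _ hB
  | systematicScan =>
    refine List.prod_induction p hmul h1 fun a ha => ?_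
    obtain ⟨i, rfl⟩ := (List.mem_ofFn' _ _).1 ha
    exact hB i

lemma blockDynamics_isMonotoneKernel {μ : Config V → ℝ} (hμ : ∀ σ, 0 < μ σ)
    (hlat : ∀ σ τ, μ σ * μ τ ≤ μ (σ ⊓ τ) * μ (σ ⊔ τ)) {r : ℕ} (hr : 0 < r)
    (B : Fin r → Finset V) (k : Rule) : IsMonotoneKernel μ (blockDynamics k μ B) :=
  blockDynamics_induction B k _ .one (fun _ _ => .mul) (fun _ => .average hr)
    fun i => blockUpdate_isMonotoneKernel hμ hlat (B i)

lemma blockDynamics_corrLE {μ : Config V → ℝ} (hμ : ∀ σ, 0 < μ σ)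
    (hlat : ∀ σ τ, μ σ * μ τ ≤ μ (σ ⊓ τ) * μ (σ ⊔ τ)) {r : ℕ}
    (B : Fin r → Finset V) (k : Rule) (S : Finset V) :
    CorrLE μ (blockDynamics k μ B) (censored k μ B S) := by
  have hle : ∀ C : Finset V, CorrLE μ (blockUpdate μ C) (blockUpdate μ (C ∩ S)) :=
    fun C _ _ => blockUpdate_censoring hμ hlat inter_subset_left
  cases k with
  | heatBath => exact CorrLE.average fun i => hle (B i)
  | systematicScan =>
    -- Both claims go through one induction: comparing products requires the censored tail to be a
    -- monotone kernel.
    have key : ∀ l : List (Finset V),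
        IsMonotoneKernel μ (l.map fun C => blockUpdate μ (C ∩ S)).prod ∧
        CorrLE μ (l.map (blockUpdate μ)).prod (l.map fun C => blockUpdate μ (C ∩ S)).prod := by
      intro l
      induction l with
      | nil => exact ⟨by simpa using .one, CorrLE.refl _⟩
      | cons C l ih =>
        simp only [List.map_cons, List.prod_cons]
        exact ⟨(blockUpdate_isMonotoneKernel hμ hlat _).mul ih.1,
          CorrLE.mul (blockUpdate_isMonotoneKernel hμ hlat C) ih.1 (hle C) ih.2⟩
    have := (key (List.ofFn B)).2
    rw [List.map_ofFn, List.map_ofFn] at this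
    exact this

/-- The censoring inequality for the gap between the extreme initial states. -/
lemma CorrLE.gap_le {μ : Config V → ℝ} (hμ : ∀ σ, 0 < μ σ)
    {K K' : Matrix (Config V) (Config V) ℝ} (hK : IsMonotoneKernel μ K)
    (hK' : IsMonotoneKernel μ K') (h : CorrLE μ K K') {f : Config V → ℝ} (f0 : 0 ≤ f)
    (hf : Monotone f) :
    K.mulVec f ⊤ - K.mulVec f ⊥ ≤ K'.mulVec f ⊤ - K'.mulVec f ⊥ := by
  -- The indicators of `{⊤}` and of the complement of `{⊥}` are increasing. The first gives `K f ⊤ ≤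
  -- K' f ⊤`; the second, with stationarity, gives `K' f ⊥ ≤ K f ⊥`.
  have h1 := h (fun x => if x = ⊤ then 1 else 0) f (fun x => by positivity) f0
    (fun x y hxy => by
      dsimp only
      split_ifs with hx hy
      · exact le_rfl
      · exact absurd (top_le_iff.1 (hx ▸ hxy)) hy
      · exact zero_le_one
      · exact le_rfl) hf
  have h2 := h (fun x => if x = ⊥ then 0 else 1) f (fun x => by
      dsimp only [Pi.zero_apply]
      split_ifs <;> norm_num) f0
    (fun x y hxy => by
      dsimp only
      split_ifs with hx hy hy
      · exact le_rfl
      · exact zero_le_one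
      · exact absurd (le_bot_iff.1 (hy ▸ hxy)) hx
      · exact le_rfl) hf
  have e : ∀ L : Matrix (Config V) (Config V) ℝ, IsMonotoneKernel μ L →
      ∑ x, μ x * (if x = ⊥ then 0 else 1) * L.mulVec f x
        = ∑ x, μ x * f x - μ ⊥ * L.mulVec f ⊥ := by
    intro L hL
    rw [← hL.stationary, eq_sub_iff_add_eq]
    have : μ ⊥ * L.mulVec f ⊥ = ∑ x, if x = ⊥ then μ x * L.mulVec f x else 0 := by simp
    rw [this, ← sum_add_distrib]
    exact sum_congr rfl fun x _ => by split_ifs <;> ring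
  rw [e K hK, e K' hK'] at h2
  simp only [mul_ite, mul_one, mul_zero, ite_mul, zero_mul, sum_ite_eq', mem_univ, if_true] at h1
  have h3 := le_of_mul_le_mul_left h1 (hμ ⊤)
  have h4 : K'.mulVec f ⊥ ≤ K.mulVec f ⊥ :=
    le_of_mul_le_mul_left (by linarith) (hμ ⊥)
  linarith

/-! ### Total variation distance and mixing times -/

section TV

variable {α : Type*} [Fintype α]

lemma tv_nonneg (p q : α → ℝ) : 0 ≤ tv p q :=
  mul_nonneg (by norm_num) (sum_nonneg fun _ _ => abs_nonneg _)

lemma tv_comm (p q : α → ℝ) : tv p q = tv q p := by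
  simp only [tv, abs_sub_comm]

lemma tv_triangle (p q s : α → ℝ) : tv p s ≤ tv p q + tv q s := by
  unfold tv
  rw [← mul_add, ← sum_add_distrib]
  exact mul_le_mul_of_nonneg_left (sum_le_sum fun x _ => abs_sub_le _ _ _) (by norm_num)

/-- The means of a function under two mass functions differ by at most the total variation
distance times the oscillation of the function. -/
lemma abs_sum_sub_sum_le_tv {p q h : α → ℝ} {C : Set α} {o : ℝ} (hpq : ∑ a, p a = ∑ a, q a)
    (hp : ∀ a ∉ C, p a = 0) (hq : ∀ a ∉ C, q a = 0)
    (ho : ∀ a ∈ C, ∀ b ∈ C, |h a - h b| ≤ o) :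
    |∑ a, p a * h a - ∑ a, q a * h a| ≤ tv p q * o := by
  classical
  -- Centring `h` at the midpoint of its range on `C` yields `o / 2`, whose factor matches the `1 /
  -- 2` in `tv`.
  obtain ⟨c, hc⟩ : ∃ c, ∀ a ∈ C, |h a - c| ≤ o / 2 := by
    by_cases hC : (univ.filter (· ∈ C)).Nonempty
    · obtain ⟨a₁, h₁, hmax⟩ := exists_max_image _ h hC
      obtain ⟨a₂, h₂, hmin⟩ := exists_min_image _ h hC
      refine ⟨(h a₁ + h a₂) / 2, fun a ha => ?_⟩
      have e₁ := hmax a (by simpa using ha)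
      have e₂ := hmin a (by simpa using ha)
      have e₃ := (abs_le.1 (ho a₁ (by simpa using h₁) a₂ (by simpa using h₂))).2
      rw [abs_le]
      constructor <;> linarith
    · refine ⟨0, fun a ha => absurd ⟨a, by simpa using ha⟩ hC⟩
  have e : ∑ a, p a * h a - ∑ a, q a * h a = ∑ a, (p a - q a) * (h a - c) := by
    have : ∑ a, (p a - q a) * (h a - c) =
        ∑ a, p a * h a - ∑ a, q a * h a - (∑ a, p a - ∑ a, q a) * c := by
      simp only [sub_mul, mul_sub, sum_sub_distrib, sum_mul]
    rw [this, hpq]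
    ring
  rw [e]
  calc |∑ a, (p a - q a) * (h a - c)| ≤ ∑ a, |p a - q a| * (o / 2) := by
        refine (abs_sum_le_sum_abs _ _).trans (sum_le_sum fun a _ => ?_)
        rw [abs_mul]
        by_cases ha : a ∈ C
        · exact mul_le_mul_of_nonneg_left (hc a ha) (abs_nonneg _)
        · simp [hp a ha, hq a ha]
    _ = tv p q * o := by
        rw [← sum_mul, tv]
        ring

/-- The test function `sign (p - q)` attains `2 * tv p q`. -/
lemma tv_le_of_forall {p q : α → ℝ} {c : ℝ}
    (h : ∀ f : α → ℝ, (∀ a, |f a| ≤ 1) → ∑ a, p a * f a - ∑ a, q a * f a ≤ 2 * c) :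
    tv p q ≤ c := by
  have := h (fun a => SignType.sign (p a - q a)) fun a => by
    rcases lt_trichotomy (p a - q a) 0 with h | h | h <;> simp [h]
  rw [← sum_sub_distrib] at this
  simp only [← sub_mul] at this
  simp only [mul_comm _ ((SignType.sign _ : SignType) : ℝ), sign_mul_self] at this
  unfold tv
  linarith

lemma tv_vecMul_le {K : Matrix α α ℝ} (h0 : ∀ x y, 0 ≤ K x y) (h1 : ∀ x, ∑ y, K x y = 1)
    (p q : α → ℝ) : tv (Matrix.vecMul p K) (Matrix.vecMul q K) ≤ tv p q := by
  unfold tv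
  refine mul_le_mul_of_nonneg_left ?_ (by norm_num)
  calc ∑ y, |Matrix.vecMul p K y - Matrix.vecMul q K y|
      ≤ ∑ y, ∑ x, |p x - q x| * K x y := by
        refine sum_le_sum fun y _ => ?_
        simp only [Matrix.vecMul, dotProduct, ← sum_sub_distrib, ← sub_mul]
        refine (abs_sum_le_sum_abs _ _).trans (sum_le_sum fun x _ => ?_)
        rw [abs_mul, abs_of_nonneg (h0 x y)]
    _ = ∑ x, |p x - q x| := by
        rw [sum_comm]
        simp only [← mul_sum, h1, mul_one]

/-- Contraction of oscillations under iteration, on a set that the chain does not leave. -/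
lemma abs_pow_mulVec_sub_le [DecidableEq α] {K : Matrix α α ℝ} (h1 : ∀ x, ∑ y, K x y = 1)
    {C : Set α} (hC : ∀ x ∈ C, ∀ y ∉ C, K x y = 0) {d o : ℝ}
    (hd : ∀ x ∈ C, ∀ y ∈ C, tv (K x) (K y) ≤ d) (o0 : 0 ≤ o) {h : α → ℝ}
    (ho : ∀ x ∈ C, ∀ y ∈ C, |h x - h y| ≤ o) (n : ℕ) :
    ∀ x ∈ C, ∀ y ∈ C, |(K ^ n).mulVec h x - (K ^ n).mulVec h y| ≤ d ^ n * o := by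
  induction n with
  | zero => simpa using ho
  | succ n ih =>
    intro x hx y hy
    have hd0 : 0 ≤ d := (tv_nonneg _ _).trans (hd x hx x hx)
    rw [pow_succ', ← Matrix.mulVec_mulVec]
    calc _ ≤ tv (K x) (K y) * (d ^ n * o) :=
          abs_sum_sub_sum_le_tv (by rw [h1, h1]) (hC x hx) (hC y hy) ih
      _ ≤ d * (d ^ n * o) := mul_le_mul_of_nonneg_right (hd x hx y hy) (by positivity)
      _ = _ := by ring

/-- By stationarity `π` may be viewed as the law at time `n` of a chain started from `π`. A test
function bounded by `1` has oscillation at most `2`, and each step contracts it by `d`. -/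
lemma tv_pow_le [DecidableEq α] {K : Matrix α α ℝ} (h1 : ∀ x, ∑ y, K x y = 1) {π : α → ℝ}
    (π0 : ∀ x, 0 ≤ π x) (π1 : ∑ x, π x = 1)
    (hπ : ∀ h, ∑ x, π x * K.mulVec h x = ∑ x, π x * h x) {d : ℝ}
    (hd : ∀ x y, tv (K x) (K y) ≤ d) (n : ℕ) (x : α) : tv ((K ^ n) x) π ≤ d ^ n := by
  have hπn : ∀ h, ∑ x, π x * (K ^ n).mulVec h x = ∑ x, π x * h x := by
    induction n with
    | zero => simp
    | succ n ih =>
      intro h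
      rw [pow_succ', ← Matrix.mulVec_mulVec, hπ, ih]
  refine tv_le_of_forall fun f hf => ?_
  have hosc := abs_pow_mulVec_sub_le (C := Set.univ) h1 (fun _ _ y hy => absurd (Set.mem_univ y) hy)
    (fun x _ y _ => hd x y) zero_le_two (h := f)
    (fun x _ y _ => (abs_sub _ _).trans (by linarith [hf x, hf y])) n
  calc (K ^ n).mulVec f x - ∑ a, π a * f a
      = ∑ a, π a * ((K ^ n).mulVec f x - (K ^ n).mulVec f a) := by
        rw [← hπn]
        simp only [mul_sub, sum_sub_distrib, ← sum_mul, π1, one_mul]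
    _ ≤ ∑ a, π a * (d ^ n * 2) := sum_le_sum fun a _ => mul_le_mul_of_nonneg_left
        ((le_abs_self _).trans (hosc x trivial a trivial)) (π0 a)
    _ = 2 * d ^ n := by
        rw [← sum_mul, π1]
        ring

end TV

lemma mixingTime_le {P : Matrix (Config V) (Config V) ℝ} {π : Config V → ℝ}
    {I : Set (Config V)} {ε : ℝ} {t : ℕ} (h : ∀ x ∈ I, tv ((P ^ t) x) π < ε) :
    mixingTime P π I ε ≤ t :=
  iSup₂_le fun x hx => iInf₂_le t (h x hx)

lemma exists_tv_lt_of_mixingTime_le {P : Matrix (Config V) (Config V) ℝ} {π : Config V → ℝ}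
    {I : Set (Config V)} {ε : ℝ} {T : ℕ} (h : mixingTime P π I ε ≤ T) {x : Config V}
    (hx : x ∈ I) : ∃ t ≤ T, tv ((P ^ t) x) π < ε := by
  by_contra! hcon
  have h1 : ((T + 1 : ℕ) : ℕ∞) ≤ mixingTime P π I ε := by
    refine le_trans ?_ (le_iSup₂ (f := fun x (_ : x ∈ I) =>
      ⨅ t ∈ {t : ℕ | tv ((P ^ t) x) π < ε}, (t : ℕ∞)) x hx)
    refine le_iInf₂ fun t ht => ?_
    have : ¬ t ≤ T := fun htT => absurd ht (not_lt.2 (hcon t htT))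
    exact_mod_cast Nat.succ_le_of_lt (not_le.1 this)
  have h2 : T + 1 ≤ T := by exact_mod_cast h1.trans h
  omega

/-! ### Censored kernels -/

/-- A stochastic matrix that changes only `S`, keeps the conditional laws of `μ` on `S`, and
preserves the functions of the configuration on `R`. -/
structure IsCensoredKernel (μ : Config V → ℝ) (S R : Finset V)
    (K : Matrix (Config V) (Config V) ℝ) : Prop where
  nonneg : ∀ x y, 0 ≤ K x y
  sum_row : ∀ x, ∑ y, K x y = 1
  support : ∀ x y, Sᶜ.restrict y ≠ Sᶜ.restrict x → K x y = 0
  -- The rows of `blockUpdate μ S` are the conditional laws on `S`, so this one identity states the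
  -- stationarity of all of them.
  stationary : blockUpdate μ S * K = blockUpdate μ S
  dependsOn : ∀ h : Config V → ℝ, DependsOn h (R : Set V) → DependsOn (K.mulVec h) (R : Set V)

namespace IsCensoredKernel

variable {μ : Config V → ℝ} {S R : Finset V}

lemma one : IsCensoredKernel μ S R 1 where
  nonneg x y := by
    rw [Matrix.one_apply]
    split_ifs <;> norm_num
  sum_row x := by simp [Matrix.one_apply]
  support x y hxy := Matrix.one_apply_ne fun h => hxy (h ▸ rfl)
  stationary := mul_one _
  dependsOn h hh := by simpa using hh

lemma mul {K L : Matrix (Config V) (Config V) ℝ} (hK : IsCensoredKernel μ S R K)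
    (hL : IsCensoredKernel μ S R L) : IsCensoredKernel μ S R (K * L) where
  nonneg x y := by
    rw [Matrix.mul_apply]
    exact sum_nonneg fun z _ => mul_nonneg (hK.nonneg x z) (hL.nonneg z y)
  sum_row x := by
    simp only [Matrix.mul_apply]
    rw [sum_comm]
    simp only [← mul_sum, hL.sum_row, mul_one, hK.sum_row]
  support x y hxy := by
    rw [Matrix.mul_apply]
    refine sum_eq_zero fun z _ => ?_
    by_cases hz : Sᶜ.restrict z = Sᶜ.restrict x
    · rw [hL.support z y (hz ▸ hxy), mul_zero]
    · rw [hK.support x z hz, zero_mul]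
  stationary := by rw [← mul_assoc, hK.stationary, hL.stationary]
  dependsOn h hh := by
    rw [← Matrix.mulVec_mulVec]
    exact hK.dependsOn _ (hL.dependsOn h hh)

lemma pow {K : Matrix (Config V) (Config V) ℝ} (hK : IsCensoredKernel μ S R K) (n : ℕ) :
    IsCensoredKernel μ S R (K ^ n) := by
  induction n with
  | zero => simpa using one
  | succ n ih =>
    rw [pow_succ]
    exact ih.mul hK

lemma average {r : ℕ} (hr : 0 < r) {K : Fin r → Matrix (Config V) (Config V) ℝ}
    (hK : ∀ i, IsCensoredKernel μ S R (K i)) :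
    IsCensoredKernel μ S R ((1 / (r : ℝ)) • ∑ i, K i) where
  nonneg x y := by
    rw [average_apply]
    exact mul_nonneg (by positivity) (sum_nonneg fun i _ => (hK i).nonneg x y)
  sum_row x := by
    simp only [average_apply]
    rw [← mul_sum, sum_comm]
    simp only [(hK _).sum_row]
    simp [hr.ne']
  support x y hxy := by
    rw [average_apply, sum_eq_zero fun i _ => (hK i).support x y hxy, mul_zero]
  stationary := by
    rw [Matrix.mul_smul, Matrix.mul_sum, sum_congr rfl fun i _ => (hK i).stationary]
    rw [sum_const, card_univ, Fintype.card_fin, ← Nat.cast_smul_eq_nsmul ℝ, smul_smul,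
      one_div_mul_cancel (by positivity), one_smul]
  dependsOn h hh x y hxy := by
    rw [average_mulVec, average_mulVec,
      sum_congr rfl fun i _ => (hK i).dependsOn h hh hxy]

/-- The mixing time only supplies some `t ≤ T` with small distance. Distance to a stationary law
does not increase, so the bound persists up to the fixed time `T`. -/
lemma tv_row_le {K : Matrix (Config V) (Config V) ℝ} (hK : IsCensoredKernel μ S R K)
    {x : Config V} {I : Set (Config V)} (hx : x ∈ I) {ε : ℝ} {T : ℕ}
    (h : mixingTime K (cond μ Sᶜ (Sᶜ.restrict x)) I ε ≤ T) :
    tv ((K ^ T) x) (blockUpdate μ S x) ≤ ε := by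
  obtain ⟨t, htT, ht⟩ := exists_tv_lt_of_mixingTime_le h hx
  obtain ⟨s, rfl⟩ := Nat.exists_eq_add_of_le htT
  have e1 : (K ^ (t + s)) x = Matrix.vecMul ((K ^ t) x) (K ^ s) := by
    rw [pow_add]
    rfl
  have e2 : blockUpdate μ S x = Matrix.vecMul (blockUpdate μ S x) (K ^ s) := by
    conv_lhs => rw [← (hK.pow s).stationary]
    rfl
  rw [e1, e2]
  exact (tv_vecMul_le (hK.pow s).nonneg (hK.pow s).sum_row _ _).trans ht.le

/-- Local mixing at time `T` within `ε` gives convergence at rate `(2 ε)^n` at times `n T`. -/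
lemma abs_pow_mulVec_sub_blockUpdate_le (hμ : ∀ σ, 0 < μ σ)
    {K : Matrix (Config V) (Config V) ℝ}
    (hK : IsCensoredKernel μ S R K) {ε : ℝ} {T : ℕ}
    (h : ∀ σ : (Sᶜ : Finset V) → Bool,
      mixingTime K (cond μ Sᶜ σ) {x | Sᶜ.restrict x = σ} ε ≤ T)
    {f : Config V → ℝ} (hf : ∀ x y, |f x - f y| ≤ 1) (n : ℕ) (x : Config V) :
    |(K ^ (T * n)).mulVec f x - (blockUpdate μ S).mulVec f x| ≤ (2 * ε) ^ n := by
  have hosc := abs_pow_mulVec_sub_le (C := {y | Sᶜ.restrict y = Sᶜ.restrict x}) (K := K ^ T)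
    (d := 2 * ε) (o := 1) (h := f) (hK.pow T).sum_row
    (fun y hy z hz => (hK.pow T).support y z (by
      have hy' : Sᶜ.restrict y = Sᶜ.restrict x := hy
      rw [hy']
      exact hz)) (fun y hy z hz => ?_) zero_le_one (fun y _ z _ => hf y z) n
  · rw [← pow_mul, mul_one] at hosc
    have e : (blockUpdate μ S).mulVec f x
        = (blockUpdate μ S).mulVec ((K ^ (T * n)).mulVec f) x := by
      rw [Matrix.mulVec_mulVec, (hK.pow _).stationary]
    have e2 : (K ^ (T * n)).mulVec f x - (blockUpdate μ S).mulVec f x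
        = ∑ y, blockUpdate μ S x y *
          ((K ^ (T * n)).mulVec f x - (K ^ (T * n)).mulVec f y) := by
      rw [e]
      simp only [mul_sub, sum_sub_distrib, ← sum_mul, blockUpdate_sum_row hμ, one_mul]
      rfl
    rw [e2]
    calc _ ≤ ∑ y, blockUpdate μ S x y * (2 * ε) ^ n := by
          refine (abs_sum_le_sum_abs _ _).trans (sum_le_sum fun y _ => ?_)
          rw [abs_mul, abs_of_nonneg (blockUpdate_nonneg hμ S x y)]
          by_cases hy : Sᶜ.restrict y = Sᶜ.restrict x
          · exact mul_le_mul_of_nonneg_left (hosc x rfl y hy) (blockUpdate_nonneg hμ S x y)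
          · rw [blockUpdate_apply, if_neg hy, zero_mul, zero_mul]
      _ = _ := by rw [← sum_mul, blockUpdate_sum_row hμ, one_mul]
  -- Two rows of `K ^ T` in one fibre are each within `ε` of the same conditional law, hence within
  -- `2 ε` of each other.
  · have e3 : ∀ y, Sᶜ.restrict y = Sᶜ.restrict x →
        tv ((K ^ T) y) (blockUpdate μ S x) ≤ ε := by
      intro y hy
      have : blockUpdate μ S x = blockUpdate μ S y := by
        ext z
        rw [blockUpdate_apply, blockUpdate_apply, hy]
      rw [this]
      exact hK.tv_row_le (I := {x | Sᶜ.restrict x = Sᶜ.restrict y}) rfl (h _)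
    have := tv_triangle ((K ^ T) y) (blockUpdate μ S x) ((K ^ T) z)
    rw [tv_comm (blockUpdate μ S x)] at this
    linarith [e3 y hy, e3 z hz]

end IsCensoredKernel

/-! ### Locality of updates inside `S`, from the factorisation of `μ`. -/

section Factor

variable {μ : Config V → ℝ} {S R : Finset V}

/-- Keeping the spins on `B` and exchanging those of `x` and `y` outside is a bijection between the
fibres that does not alter the spins on `R`. -/
lemma sum_fiber_eq_of_dependsOn {R B : Finset V} {g : Config V → ℝ}
    (hg : DependsOn g (R : Set V)) {x y : Config V} (hxy : ∀ v ∈ R, x v = y v) :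
    ∑ ρ with Bᶜ.restrict ρ = Bᶜ.restrict x, g ρ = ∑ ρ with Bᶜ.restrict ρ = Bᶜ.restrict y, g ρ := by
  simp only [restrict_eq_restrict, mem_compl]
  refine sum_nbij' (fun ρ v => if v ∈ B then ρ v else y v) (fun ρ v => if v ∈ B then ρ v else x v)
    ?_ ?_ ?_ ?_ ?_
  · intro ρ _
    simp +contextual
  · intro ρ _
    simp +contextual
  · intro ρ hρ
    ext v
    by_cases hv : v ∈ B
    · simp [hv]
    · simp [hv, (mem_filter.1 hρ).2 v hv]
  · intro ρ hρ
    ext v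
    by_cases hv : v ∈ B
    · simp [hv]
    · simp [hv, (mem_filter.1 hρ).2 v hv]
  · intro ρ hρ
    refine hg fun v hv => ?_
    by_cases hvB : v ∈ B
    · simp [hvB]
    · simp [hvB, (mem_filter.1 hρ).2 v hvB, hxy v hv]

/-- Since `B ⊆ S`, the factor `b` is constant on each fibre and cancels from the conditional
expectation, leaving `a` and `h`, which see only `R`. -/
lemma blockUpdate_dependsOn_of_factor (hμ : ∀ σ, 0 < μ σ)
    {a b : Config V → ℝ} (hab : ∀ σ, μ σ = a σ * b σ) (ha : DependsOn a (R : Set V))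
    (hb : DependsOn b ((Sᶜ : Finset V) : Set V)) {B : Finset V} (hB : B ⊆ S)
    {h : Config V → ℝ} (hh : DependsOn h (R : Set V)) :
    DependsOn ((blockUpdate μ B).mulVec h) (R : Set V) := by
  have key : ∀ x, (blockUpdate μ B).mulVec h x =
      (∑ ρ with Bᶜ.restrict ρ = Bᶜ.restrict x, a ρ * h ρ) /
        ∑ ρ with Bᶜ.restrict ρ = Bᶜ.restrict x, a ρ := by
    intro x
    have hbx : b x ≠ 0 := fun h0 => (hμ x).ne' (by rw [hab, h0, mul_zero])
    have e : ∀ ρ ∈ univ.filter (fun ρ => Bᶜ.restrict ρ = Bᶜ.restrict x), b ρ = b x :=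
      fun ρ hρ => hb fun v hv => restrict_eq_restrict.1 (mem_filter.1 hρ).2 v
        (compl_subset_compl.2 hB hv)
    rw [blockUpdate_mulVec, sum_congr rfl fun ρ hρ => show μ ρ * h ρ = a ρ * h ρ * b x by
        rw [hab, e ρ hρ]
        ring, sum_congr rfl fun ρ hρ => show μ ρ = a ρ * b x by rw [hab, e ρ hρ],
      ← sum_mul, ← sum_mul, mul_div_mul_right _ _ hbx]
  intro x y hxy
  rw [key, key, sum_fiber_eq_of_dependsOn ha hxy,
    sum_fiber_eq_of_dependsOn (g := fun ρ => a ρ * h ρ)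
      (fun σ τ hστ => by simp only [ha hστ, hh hστ]) hxy]

lemma blockUpdate_isCensoredKernel (hμ : ∀ σ, 0 < μ σ)
    {a b : Config V → ℝ} (hab : ∀ σ, μ σ = a σ * b σ) (ha : DependsOn a (R : Set V))
    (hb : DependsOn b ((Sᶜ : Finset V) : Set V)) {B : Finset V} (hB : B ⊆ S) :
    IsCensoredKernel μ S R (blockUpdate μ B) where
  nonneg := blockUpdate_nonneg hμ B
  sum_row := blockUpdate_sum_row hμ B
  support x y hxy := by
    rw [blockUpdate_apply, if_neg]
    rw [Ne, restrict_eq_restrict] at hxy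
    rw [restrict_eq_restrict]
    exact fun h => hxy fun v hv => h v (compl_subset_compl.2 hB hv)
  stationary := by
    refine Matrix.mulVec_injective (funext fun h => ?_)
    rw [← Matrix.mulVec_mulVec, blockUpdate_mulVec_blockUpdate hμ hB]
  dependsOn _ hh := blockUpdate_dependsOn_of_factor hμ hab ha hb hB hh

end Factor

/-! ### Influence of the boundary -/

/-- The indicator function of the spin `1` at `v`. -/
def spin (v : V) (x : Config V) : ℝ := if x v = true then 1 else 0

lemma spin_nonneg (v : V) : 0 ≤ spin v := fun x => by
  unfold spin
  split_ifs <;> norm_num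

lemma spin_le_one (v : V) (x : Config V) : spin v x ≤ 1 := by
  unfold spin
  split_ifs <;> norm_num

lemma abs_spin_sub_le (v : V) (x y : Config V) : |spin v x - spin v y| ≤ 1 := by
  unfold spin
  split_ifs <;> norm_num

lemma spin_monotone (v : V) : Monotone (spin v) := by
  intro x y hxy
  have h := hxy v
  unfold spin
  rcases hx : x v <;> rcases hy : y v <;> simp_all
  exact absurd h (show ¬ (true ≤ false) by decide)

lemma spin_dependsOn {v : V} {A : Finset V} (hv : v ∈ A) : DependsOn (spin v) (A : Set V) :=
  fun x y hxy => by rw [spin, spin, hxy v hv]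

lemma hammingDist_path_le {ι : Type*} [Fintype ι] {β : ι → Type*} [∀ i, DecidableEq (β i)]
    (d : ℕ) (η : ℕ → ∀ i, β i) (h : ∀ i < d, hammingDist (η i) (η (i + 1)) = 1) :
    hammingDist (η 0) (η d) ≤ d := by
  induction d with
  | zero => simp
  | succ d ih =>
    have h1 := hammingDist_triangle (η 0) (η d) (η (d + 1))
    have h2 := ih fun i hi => h i (by omega)
    rw [h d (by omega)] at h1
    omega

/-- Along a shortest path of configurations every coordinate is changed at most once. -/
lemma abs_sub_le_sum_of_path {ι : Type*} [Fintype ι] {β : ι → Type*} [∀ i, DecidableEq (β i)]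
    {m : (∀ i, β i) → ℝ} {a : ι → ℝ} {G : Set (∀ i, β i)}
    (hstep : ∀ σ ∈ G, ∀ σ' u, (∀ w, w ≠ u → σ' w = σ w) → |m σ - m σ'| ≤ a u)
    (d : ℕ) : ∀ η : ℕ → ∀ i, β i, (∀ i ≤ d, η i ∈ G) →
      (∀ i < d, hammingDist (η i) (η (i + 1)) = 1) → hammingDist (η 0) (η d) = d →
      |m (η 0) - m (η d)| ≤ ∑ u with η 0 u ≠ η d u, a u := by
  classical
  induction d with
  | zero => simp
  | succ d ih =>
    intro η hG h1 hd
    have hle := hammingDist_path_le d (fun i => η (i + 1)) fun i hi => h1 (i + 1) (by omega)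
    have htri := hammingDist_triangle (η 0) (η 1) (η (d + 1))
    have h01 : hammingDist (η 0) (η 1) = 1 := h1 0 (by omega)
    have hd' : hammingDist (η 1) (η (d + 1)) = d := by
      simp only [zero_add] at hle
      omega
    have hrec := ih (fun i => η (i + 1)) (fun i hi => hG (i + 1) (by omega))
      (fun i hi => h1 (i + 1) (by omega)) hd'
    simp only [zero_add] at hrec
    obtain ⟨u, hu⟩ := card_eq_one.1 h01
    have hne : ∀ w, w ≠ u → η 1 w = η 0 w := by
      intro w hw
      by_contra hcon
      have : w ∈ ({i | η 0 i ≠ η 1 i} : Finset ι) := by simpa using fun h => hcon h.symm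
      rw [hu, mem_singleton] at this
      exact hw this
    have hsub : ({i | η 0 i ≠ η (d + 1) i} : Finset ι) ⊆
        insert u ({i | η 1 i ≠ η (d + 1) i} : Finset ι) := by
      intro w hw
      rw [mem_insert]
      by_cases hwu : w = u
      · exact Or.inl hwu
      · refine Or.inr ?_
        simpa [hne w hwu] using hw
    -- Counting shows that `u`, changed in the first step, is not changed again: the `d + 1`
    -- differences must be `u` together with the `d` differences that remain after that step.
    have hcard : ({i | η 0 i ≠ η (d + 1) i} : Finset ι).card = d + 1 := hd
    have hcard' : ({i | η 1 i ≠ η (d + 1) i} : Finset ι).card = d := hd'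
    have hu' : u ∉ ({i | η 1 i ≠ η (d + 1) i} : Finset ι) := by
      intro hmem
      have := card_le_card hsub
      rw [insert_eq_of_mem hmem] at this
      omega
    have heq := eq_of_subset_of_card_le hsub (by rw [card_insert_of_notMem hu']; omega)
    rw [heq, sum_insert hu']
    have := hstep (η 0) (hG 0 (by omega)) (η 1) u hne
    have h3 := abs_sub_le (m (η 0)) (m (η 1)) (m (η (d + 1)))
    linarith

section Influence

variable {μ : Config V → ℝ} (hμ : ∀ σ, 0 < μ σ)

include hμ

lemma sum_cond (A : Finset V) (σ : A → Bool) : ∑ τ, cond μ A σ τ = 1 := by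
  unfold cond
  rw [← sum_filter, ← sum_div]
  refine div_self (sum_pos (fun ρ _ => hμ ρ)
    ⟨fun v => if h : v ∈ A then σ ⟨v, h⟩ else false, ?_⟩).ne'
  simp only [mem_filter, mem_univ, true_and]
  ext v
  simp

omit hμ in
lemma marginal_true (p : Config V → ℝ) (v : V) : marginal p v true = ∑ τ, p τ * spin v τ := by
  simp [marginal, spin, sum_filter]

omit hμ in
lemma marginal_false (p : Config V → ℝ) (v : V) :
    marginal p v false = ∑ τ, p τ - marginal p v true := by
  rw [eq_sub_iff_add_eq, marginal, marginal, add_comm]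
  simpa using sum_filter_add_sum_filter_not univ (fun τ : Config V => τ v = true) p

lemma tv_marginal_cond (A : Finset V) (σ σ' : A → Bool) (v : V) :
    tv (marginal (cond μ A σ) v) (marginal (cond μ A σ') v)
      = |marginal (cond μ A σ) v true - marginal (cond μ A σ') v true| := by
  unfold tv
  rw [Fintype.sum_bool, marginal_false, marginal_false, sum_cond hμ, sum_cond hμ,
    sub_sub_sub_cancel_left, abs_sub_comm (marginal (cond μ A σ') v true)]
  ring

lemma abs_marginal_sub_le_influence (v : V) (D : Finset V) (Good : Set (D → Bool))
    {σ : D → Bool} (hσ : σ ∈ Good) (σ' : D → Bool) (u : D) (h : ∀ w, w ≠ u → σ' w = σ w) :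
    |marginal (cond μ D σ) v true - marginal (cond μ D σ') v true| ≤ influence μ v D Good u := by
  have hsup := le_ciSup (f := fun σ : Good =>
    tv (marginal (cond μ D (Function.update σ.1 u false)) v)
      (marginal (cond μ D (Function.update σ.1 u true)) v)) (Set.finite_range _).bddAbove ⟨σ, hσ⟩
  refine le_trans ?_ hsup
  dsimp only
  rw [tv_marginal_cond hμ]
  have e : ∀ c, σ' u = c → σ' = Function.update σ u c := by
    rintro c rfl
    ext w
    by_cases hw : w = u
    · subst hw
      simp
    · simp [hw, h w hw]
  have e' : ∀ c, σ u = c → Function.update σ u c = σ := by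
    rintro c rfl
    simp
  -- Only `σ` has to be good: the influence overwrites the spin at `u`, so `σ'` is one of its two
  -- compared configurations.
  rcases hc : σ u <;> rcases hc' : σ' u <;> rw [e _ hc', e' _ hc]
  · simp
  · rw [abs_sub_comm]
  · simp

/-- The mean after an update of `S` only depends on the boundary of `S`. -/
lemma blockUpdate_dependsOn_boundary {S D : Finset V} {a b : Config V → ℝ}
    (hab : ∀ σ, μ σ = a σ * b σ) (ha : DependsOn a ((S ∪ D : Finset V) : Set V))
    (hb : DependsOn b ((Sᶜ : Finset V) : Set V))
    {h : Config V → ℝ} (hh : DependsOn h ((S ∪ D : Finset V) : Set V)) (hSD : Disjoint D S) :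
    DependsOn ((blockUpdate μ S).mulVec h) (D : Set V) := by
  intro x y hxy
  -- The update forgets the spins on `S`, so those of `x` may be replaced by those of `y`; the two
  -- configurations then agree on `S ∪ D`.
  have h1 := blockUpdate_dependsOn (μ := μ) S h (x := x)
    (y := fun v => if v ∈ S then y v else x v) fun v hv => by
      have : v ∉ S := by simpa using hv
      simp [this]
  rw [h1]
  refine blockUpdate_dependsOn_of_factor hμ hab ha hb Subset.rfl hh fun v hv => ?_
  rcases mem_union.1 (mem_coe.1 hv) with hv | hv
  · simp [hv]
  · simp [disjoint_left.1 hSD hv, hxy v hv]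

/-- Spatial Markov property: the mean at `v` given everything outside `S` is a function of the spins
on `D`, so averaging over the other outside spins changes nothing. It links the influences, defined
by conditioning on `D`, to the update of `S`. -/
lemma marginal_cond_eq_blockUpdate {S D : Finset V} (hSD : Disjoint D S) {v : V}
    (hdep : DependsOn ((blockUpdate μ S).mulVec (spin v)) (D : Set V)) (x : Config V) :
    marginal (cond μ D (D.restrict x)) v true = (blockUpdate μ S).mulVec (spin v) x := by
  have hZ := fiber_sum_pos hμ D x
  have e : marginal (cond μ D (D.restrict x)) v true
      = (∑ τ with D.restrict τ = D.restrict x, μ τ * spin v τ) /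
        ∑ ρ with D.restrict ρ = D.restrict x, μ ρ := by
    rw [marginal_true, sum_filter, sum_div]
    refine sum_congr rfl fun τ _ => ?_
    unfold cond
    split_ifs
    · ring
    · simp
  rw [e, ← sum_fiber_blockUpdate hμ hSD, div_eq_iff hZ.ne', mul_sum]
  refine sum_congr rfl fun ρ hρ => ?_
  rw [mul_comm, hdep (restrict_eq_restrict.1 (mem_filter.1 hρ).2)]

end Influence

lemma disjoint_outerBoundary (G : SimpleGraph V) (S : Finset V) :
    Disjoint (outerBoundary G S) S := by
  rw [disjoint_left]
  intro v hv
  simp only [outerBoundary, mem_filter] at hv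
  exact hv.2.1

lemma influence_nonneg (μ : Config V → ℝ) (v : V) (D : Finset V) (Good : Set (D → Bool)) (u : D) :
    0 ≤ influence μ v D Good u :=
  Real.iSup_nonneg fun _ => tv_nonneg _ _

/-! ### Sensitivity of the spin at `v` to the initial state of the local dynamics. -/

section Local

variable {M : System V} {k : Rule} {r : ℕ} {B : Fin r → Finset V} {v : V} {S : Finset V}
  {Good : Set (outerBoundary M.graph S → Bool)} {Tloc : ℕ}

lemma IsGood.blockUpdate_spin_dependsOn (hG : IsGood M k B v S Good Tloc) :
    DependsOn ((blockUpdate M.gibbs S).mulVec (spin v)) (outerBoundary M.graph S : Set V) := by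
  obtain ⟨a, b, hab, ha, hb⟩ := M.exists_gibbs_eq_mul S
  exact blockUpdate_dependsOn_boundary M.gibbs_pos hab ha hb
    (spin_dependsOn (mem_union_left _ hG.mem)) (disjoint_outerBoundary _ _)

/-- Deform one boundary condition into the other along a shortest path inside `Good`: each
disagreeing vertex is flipped once and costs its influence. Indicators make the bound linear in the
disagreements, ready for taking expectations. -/
lemma IsGood.blockUpdate_spin_sub_le (hG : IsGood M k B v S Good Tloc) {x y : Config V}
    (hx : (outerBoundary M.graph S).restrict x ∈ Good)
    (hy : (outerBoundary M.graph S).restrict y ∈ Good) :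
    (blockUpdate M.gibbs S).mulVec (spin v) x - (blockUpdate M.gibbs S).mulVec (spin v) y ≤
      ∑ u : outerBoundary M.graph S,
        influence M.gibbs v (outerBoundary M.graph S) Good u * if x u ≠ y u then 1 else 0 := by
  rw [← marginal_cond_eq_blockUpdate M.gibbs_pos (disjoint_outerBoundary _ _)
      hG.blockUpdate_spin_dependsOn x,
    ← marginal_cond_eq_blockUpdate M.gibbs_pos (disjoint_outerBoundary _ _)
      hG.blockUpdate_spin_dependsOn y]
  obtain ⟨η, h0, hd, hη, h1⟩ := hG.closed_under_shortest_paths _ hx _ hy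
  have := abs_sub_le_sum_of_path
    (m := fun σ => marginal (cond M.gibbs (outerBoundary M.graph S) σ) v true)
    (a := influence M.gibbs v (outerBoundary M.graph S) Good) (G := Good)
    (fun σ hσ σ' u hu => abs_marginal_sub_le_influence M.gibbs_pos v _ Good hσ σ' u hu)
    _ η hη h1 (by rw [h0, hd])
  rw [h0, hd] at this
  refine (le_abs_self _).trans (this.trans (le_of_eq ?_))
  rw [sum_filter]
  exact sum_congr rfl fun u _ => by rw [mul_ite, mul_one, mul_zero]; rfl

/-- Comparison of two initial states for the censored dynamics, after local mixing. -/
lemma IsGood.censored_spin_sub_le (hG : IsGood M k B v S Good Tloc) (hr : 0 < r) (n : ℕ)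
    {δ : ℝ} (hδ : (2 * (1 / (4 * Real.exp 1))) ^ n ≤ δ) [DecidablePred (· ∈ Good)]
    (x y : Config V) :
    ((censored k M.gibbs B S) ^ (Tloc * n)).mulVec (spin v) x
      - ((censored k M.gibbs B S) ^ (Tloc * n)).mulVec (spin v) y ≤
      (if (outerBoundary M.graph S).restrict x ∉ Good ∨ (outerBoundary M.graph S).restrict y ∉ Good
        then 1 else 0) +
      (∑ u ∈ S ∪ outerBoundary M.graph S, 2 * δ * (if x u ≠ y u then 1 else 0) +
      ∑ u : outerBoundary M.graph S,
        influence M.gibbs v (outerBoundary M.graph S) Good u * if x u ≠ y u then 1 else 0) := by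
  obtain ⟨a, b, hab, ha, hb⟩ := M.exists_gibbs_eq_mul S
  have hδ0 : 0 ≤ δ := le_trans (by positivity) hδ
  have hK : IsCensoredKernel M.gibbs S (S ∪ outerBoundary M.graph S) (censored k M.gibbs B S) :=
    blockDynamics_induction _ k _ .one (fun _ _ => .mul) (fun _ => .average hr)
      fun i => blockUpdate_isCensoredKernel M.gibbs_pos hab ha hb inter_subset_right
  have hn1 : 0 ≤ ∑ u ∈ S ∪ outerBoundary M.graph S, 2 * δ * (if x u ≠ y u then 1 else 0) :=
    sum_nonneg fun u _ => by positivity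
  have hn2 : 0 ≤ ∑ u : outerBoundary M.graph S,
      influence M.gibbs v (outerBoundary M.graph S) Good u * (if x u ≠ y u then 1 else 0 : ℝ) :=
    sum_nonneg fun u _ => mul_nonneg (influence_nonneg _ _ _ _ _) (by positivity)
  split_ifs with hbad
  · have h1 : ((censored k M.gibbs B S) ^ (Tloc * n)).mulVec (spin v) x ≤ 1 := by
      rw [← (hK.pow (Tloc * n)).sum_row x]
      exact sum_le_sum fun z _ =>
        mul_le_of_le_one_right ((hK.pow _).nonneg x z) (spin_le_one v z)
    have h2 := mulVec_nonneg (hK.pow (Tloc * n)).nonneg (spin_nonneg v) y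
    simp only [Pi.zero_apply] at h2
    linarith
  · push Not at hbad
    -- Agreement on `R` makes the difference exactly zero. Otherwise a single disagreement pays for
    -- the local mixing error `2 δ`. Hence this error is multiplied by the expected number of
    -- disagreements in `R`, and `K` of order `log |R|` suffices.
    by_cases heq : ∀ u ∈ S ∪ outerBoundary M.graph S, x u = y u
    · have h1 := (hK.pow (Tloc * n)).dependsOn (spin v)
        (spin_dependsOn (mem_union_left _ hG.mem)) heq
      linarith
    · push Not at heq
      obtain ⟨u, hu, hne⟩ := heq
      have h1 := hG.blockUpdate_spin_sub_le hbad.1 hbad.2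
      have h2 := fun z => abs_le.1 ((hK.abs_pow_mulVec_sub_blockUpdate_le M.gibbs_pos
        hG.local_mixing (abs_spin_sub_le v) n z).trans hδ)
      have h3 := single_le_sum (f := fun u => 2 * δ * (if x u ≠ y u then 1 else 0 : ℝ))
        (fun u _ => by positivity) hu
      simp only [if_pos hne, mul_one] at h3
      linarith [(h2 x).2, (h2 y).1]

end Local

/-! ### The grand coupling -/

instance : IsProbabilityMeasure (seqLaw V) := by
  unfold seqLaw
  infer_instance

section Chain

variable {P : Matrix (Config V) (Config V) ℝ} {f : Config V → Cube V → Config V}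
  (hf : IsMonotoneCoupling P f)

/-- The state at time `t` only depends on the randomness before time `t`. -/
lemma chain_congr (f : Config V → Cube V → Config V) (x : Config V) {ω ω' : ℕ → Cube V} {t : ℕ}
    (h : ∀ i < t, ω i = ω' i) : chain f x ω t = chain f x ω' t := by
  induction t with
  | zero => rfl
  | succ t ih =>
    rw [chain, chain, ih fun i hi => h i (by omega), h t (by omega)]

include hf

lemma IsMonotoneCoupling.measurable_uncurry :
    Measurable fun p : Config V × Cube V => f p.1 p.2 :=
  measurable_from_prod_countable_right hf.measurable

lemma IsMonotoneCoupling.measurable_chain (x : Config V) (t : ℕ) :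
    Measurable fun ω => chain f x ω t := by
  induction t with
  | zero => exact measurable_const
  | succ t ih => exact hf.measurable_uncurry.comp (ih.prodMk (measurable_pi_apply t))

lemma IsMonotoneCoupling.ae_chain_le :
    ∀ᵐ ω ∂seqLaw V, ∀ x y, x ≤ y → ∀ t, chain f x ω t ≤ chain f y ω t := by
  have h1 : ∀ᵐ r ∂(volume : Measure (Cube V)), ∀ σ σ', σ ≤ σ' → f σ r ≤ f σ' r := by
    rw [ae_all_iff]
    intro σ
    rw [ae_all_iff]
    intro σ'
    by_cases h : σ ≤ σ'
    · filter_upwards [hf.monotone σ σ' h] with r hr _ using hr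
    · exact Filter.Eventually.of_forall fun r h' => absurd h' h
  have h2 : ∀ᵐ ω ∂seqLaw V, ∀ t, ∀ σ σ', σ ≤ σ' → f σ (ω t) ≤ f σ' (ω t) :=
    ae_all_iff.2 fun t =>
      (measurePreserving_eval_infinitePi (fun _ : ℕ => (volume : Measure (Cube V)))
        t).quasiMeasurePreserving.ae h1
  filter_upwards [h2] with ω hω x y hxy t
  induction t with
  | zero => exact hxy
  | succ t ih => exact hω t _ _ ih

lemma IsMonotoneCoupling.integrable_chain (x y : Config V) (t : ℕ) (G : Config V → Config V → ℝ) :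
    Integrable (fun ω => G (chain f x ω t) (chain f y ω t)) (seqLaw V) := by
  refine Integrable.of_bound (C := ∑ p : Config V × Config V, |G p.1 p.2|)
    ((measurable_of_countable fun p : Config V × Config V => G p.1 p.2).comp
      ((hf.measurable_chain x t).prodMk (hf.measurable_chain y t))).aestronglyMeasurable
    (Filter.Eventually.of_forall fun ω => ?_)
  exact single_le_sum (f := fun p : Config V × Config V => |G p.1 p.2|)
    (fun p _ => abs_nonneg _) (mem_univ (chain f x ω t, chain f y ω t))

lemma IsMonotoneCoupling.indepFun_chain (x : Config V) (t : ℕ) :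
    ProbabilityTheory.IndepFun (fun ω => chain f x ω t) (fun ω => ω t) (seqLaw V) := by
  have h1 : ProbabilityTheory.iIndepFun (fun (i : ℕ) (ω : ℕ → Cube V) => ω i) (seqLaw V) :=
    ProbabilityTheory.iIndepFun_infinitePi (X := fun _ r => r) fun _ => measurable_id
  have h2 := h1.indepFun_finset (range t) {t} (by simp) fun i => measurable_pi_apply i
  -- Padding the first `t` random inputs by `0` exhibits the state at time `t` as a measurable
  -- function of them alone.
  set e : (range t → Cube V) → ℕ → Cube V :=
    fun r i => if h : i ∈ range t then r ⟨i, h⟩ else 0 with he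
  have hem : Measurable e := measurable_pi_lambda _ fun i => by
    by_cases h : i ∈ range t
    · simpa only [he, h, dite_true] using measurable_pi_apply _
    · simpa only [he, h, dite_false] using measurable_const
  have h3 := h2.comp ((hf.measurable_chain x t).comp hem)
    (measurable_pi_apply (⟨t, mem_singleton_self t⟩ : ({t} : Finset ℕ)))
  refine h3.congr (Filter.Eventually.of_forall fun ω => ?_) (Filter.Eventually.of_forall fun ω => rfl)
  exact chain_congr f x fun i hi => by simp [he, hi]

lemma IsMonotoneCoupling.integral_step (x : Config V) (g : Config V → ℝ) :
    ∫ r, g (f x r) ∂(volume : Measure (Cube V)) = P.mulVec g x := by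
  have e : ∀ r, g (f x r) = ∑ τ, ({r | f x r = τ} : Set (Cube V)).indicator (fun _ => g τ) r := by
    intro r
    simp [Set.indicator_apply]
  have hms : ∀ τ, MeasurableSet {r | f x r = τ} := fun τ =>
    hf.measurable x (measurableSet_singleton τ)
  simp only [e]
  rw [integral_finsetSum _ fun τ _ => (integrable_const _).indicator (hms τ)]
  simp only [integral_indicator_const _ (hms _), hf.law, smul_eq_mul]
  rfl

lemma IsMonotoneCoupling.integral_chain (x : Config V) (t : ℕ) (g : Config V → ℝ) :
    ∫ ω, g (chain f x ω t) ∂seqLaw V = (P ^ t).mulVec g x := by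
  induction t generalizing g with
  | zero => simp [chain]
  | succ t ih =>
    have hind := (hf.indepFun_chain x t)
    -- Splitting over the state `z` at time `t` gives products of a function of the past and a
    -- function of `ω t`, so independence applies.
    have e : ∀ ω, g (chain f x ω (t + 1)) =
        ∑ z, (if chain f x ω t = z then 1 else 0) * g (f z (ω t)) := by
      intro ω
      simp [chain]
    have hm1 : ∀ z, Measurable fun y : Config V => (if y = z then 1 else 0 : ℝ) :=
      fun z => measurable_of_countable _
    have hm2 : ∀ z, Measurable fun r : Cube V => g (f z r) :=
      fun z => (measurable_of_countable g).comp (hf.measurable z)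
    have hmp := measurePreserving_eval_infinitePi (fun _ : ℕ => (volume : Measure (Cube V))) t
    have key : ∀ z, ∫ ω, (if chain f x ω t = z then 1 else 0) * g (f z (ω t)) ∂seqLaw V
        = (∫ ω, (if chain f x ω t = z then 1 else 0) ∂seqLaw V) * P.mulVec g z := by
      intro z
      have h1 := (hind.comp (hm1 z) (hm2 z)).integral_fun_mul_eq_mul_integral
        ((hm1 z).comp (hf.measurable_chain x t)).aestronglyMeasurable
        ((hm2 z).comp (measurable_pi_apply t)).aestronglyMeasurable
      have h2 : ∫ ω, g (f z (ω t)) ∂seqLaw V = P.mulVec g z := by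
        rw [← hf.integral_step z g, ← hmp.map_eq,
          integral_map hmp.measurable.aemeasurable (hm2 z).aestronglyMeasurable]
        rfl
      rw [← h2]
      exact h1
    rw [pow_succ, ← Matrix.mulVec_mulVec, ← ih]
    simp only [e]
    rw [integral_finsetSum _ fun z _ => ?_]
    · simp only [key, ← integral_mul_const]
      rw [← integral_finsetSum _ fun z _ =>
        hf.integrable_chain x x t fun y _ => (if y = z then 1 else 0) * P.mulVec g z]
      simp
    · refine Integrable.of_bound (C := |g ⊤| + ∑ y, |g y|)
        ((((hm1 z).comp (hf.measurable_chain x t)).mul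
          ((hm2 z).comp (measurable_pi_apply t))).aestronglyMeasurable)
        (Filter.Eventually.of_forall fun ω => ?_)
      have h1 := single_le_sum (f := fun y => |g y|) (fun y _ => abs_nonneg _)
        (mem_univ (f z (ω t)))
      have h2 := abs_nonneg (g ⊤)
      have h3 := abs_nonneg (g (f z (ω t)))
      simp only [Real.norm_eq_abs]
      split_ifs <;> simp <;> linarith

/-- The probability that the extreme chains disagree at `v`. -/
lemma IsMonotoneCoupling.integral_ne_eq (v : V) (t : ℕ) :
    ∫ ω, (if chain f ⊤ ω t v ≠ chain f ⊥ ω t v then 1 else 0 : ℝ) ∂seqLaw V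
      = (P ^ t).mulVec (spin v) ⊤ - (P ^ t).mulVec (spin v) ⊥ := by
  rw [← hf.integral_chain, ← hf.integral_chain, ← integral_sub
    (hf.integrable_chain ⊤ ⊤ t fun x _ => spin v x) (hf.integrable_chain ⊥ ⊥ t fun x _ => spin v x)]
  refine integral_congr_ae ?_
  filter_upwards [hf.ae_chain_le] with ω hω
  have h := hω ⊥ ⊤ bot_le t v
  unfold spin
  rcases h1 : chain f ⊤ ω t v <;> rcases h2 : chain f ⊥ ω t v <;> simp_all
  exact absurd h (show ¬ (true ≤ false) by decide)

/-- Coupling inequality with sandwiching: if the chains from `x` and `y` differ at a vertex, so do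
the extreme chains. A union bound over the vertices concludes. -/
lemma IsMonotoneCoupling.tv_pow_le_sum (x y : Config V) (t : ℕ) :
    tv ((P ^ t) x) ((P ^ t) y)
      ≤ ∑ v, ((P ^ t).mulVec (spin v) ⊤ - (P ^ t).mulVec (spin v) ⊥) := by
  refine tv_le_of_forall fun g hg => ?_
  have e : ∑ a, (P ^ t) x a * g a - ∑ a, (P ^ t) y a * g a
      = ∫ ω, (g (chain f x ω t) - g (chain f y ω t)) ∂seqLaw V := by
    rw [integral_sub (hf.integrable_chain x x t fun z _ => g z)
      (hf.integrable_chain y y t fun z _ => g z), hf.integral_chain, hf.integral_chain]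
    rfl
  have hI : ∀ v : V, Integrable
      (fun ω => (if chain f ⊤ ω t v ≠ chain f ⊥ ω t v then 1 else 0 : ℝ)) (seqLaw V) :=
    fun v => hf.integrable_chain ⊤ ⊥ t fun a b => if a v ≠ b v then 1 else 0
  simp only [← hf.integral_ne_eq]
  rw [e, ← integral_finsetSum _ fun v _ => hI v, ← integral_const_mul]
  refine integral_mono_ae
    ((hf.integrable_chain x x t fun z _ => g z).sub (hf.integrable_chain y y t fun z _ => g z))
    ((integrable_finsetSum _ fun v _ => hI v).const_mul 2) ?_
  filter_upwards [hf.ae_chain_le] with ω hω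
  have hnn : ∀ v ∈ univ, (0 : ℝ) ≤ if chain f ⊤ ω t v ≠ chain f ⊥ ω t v then 1 else 0 :=
    fun v _ => by positivity
  by_cases heq : chain f x ω t = chain f y ω t
  · rw [heq, sub_self]
    exact mul_nonneg zero_le_two (sum_nonneg hnn)
  · obtain ⟨v, hv⟩ := Function.ne_iff.1 heq
    have hne : chain f ⊤ ω t v ≠ chain f ⊥ ω t v := by
      intro h
      have h1 := fun z => hω z ⊤ le_top t v
      have h2 := fun z => hω ⊥ z bot_le t v
      rw [← h] at h2
      exact hv (((h1 x).antisymm (h2 x)).trans ((h1 y).antisymm (h2 y)).symm)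
    have h1 := single_le_sum hnn (mem_univ v)
    rw [if_pos hne] at h1
    have h2 := abs_le.1 (hg (chain f x ω t))
    have h3 := abs_le.1 (hg (chain f y ω t))
    linarith

end Chain

/-! ### Contraction of the disagreement probabilities -/

/-- The difference of the probabilities of the spin `1` at `v` at time `t` from the two extreme
initial states. -/
noncomputable def gap (P : Matrix (Config V) (Config V) ℝ) (t : ℕ) (v : V) : ℝ :=
  (P ^ t).mulVec (spin v) ⊤ - (P ^ t).mulVec (spin v) ⊥

section Gap

variable {P : Matrix (Config V) (Config V) ℝ} {f : Config V → Cube V → Config V}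

lemma IsMonotoneCoupling.gap_nonneg (hf : IsMonotoneCoupling P f) (t : ℕ) (v : V) :
    0 ≤ gap P t v := by
  rw [gap, ← hf.integral_ne_eq]
  exact integral_nonneg fun ω => by dsimp only [Pi.zero_apply]; positivity

lemma IsMonotoneCoupling.gap_le_one (hf : IsMonotoneCoupling P f) (t : ℕ) (v : V) :
    gap P t v ≤ 1 := by
  rw [gap, ← hf.integral_ne_eq]
  calc _ ≤ ∫ _ω, (1 : ℝ) ∂seqLaw V := by
        refine integral_mono (hf.integrable_chain ⊤ ⊥ t fun a b => if a v ≠ b v then 1 else 0)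
          (integrable_const _) fun ω => ?_
        dsimp only
        split_ifs <;> norm_num
    _ = 1 := by simp

variable {M : System V} {k : Rule} {r : ℕ} {B : Fin r → Finset V} {v : V} {S : Finset V}
  {Good : Set (outerBoundary M.graph S → Bool)} {Tloc : ℕ}

/-- One round of the recursion: censor the last `Tloc * n` steps, compare the two states at time `t`
by `IsGood.censored_spin_sub_le`, and take expectations under the grand coupling. -/
lemma IsGood.gap_add_le (hM : M.Ferromagnetic) (hr : 0 < r)
    (hf : IsMonotoneCoupling (blockDynamics k M.gibbs B) f)
    (hG : IsGood M k B v S Good Tloc) (t n : ℕ) {δ b p : ℝ}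
    (hδ : (2 * (1 / (4 * Real.exp 1))) ^ n ≤ δ)
    (hb : (seqLaw V).real {ω | (outerBoundary M.graph S).restrict (chain f ⊤ ω t) ∉ Good ∨
      (outerBoundary M.graph S).restrict (chain f ⊥ ω t) ∉ Good} ≤ b)
    (hp : ∀ u, gap (blockDynamics k M.gibbs B) t u ≤ p) :
    gap (blockDynamics k M.gibbs B) (t + Tloc * n) v ≤
      b + (2 * δ * (S ∪ outerBoundary M.graph S).card + 1 / 20) * p := by
  classical
  set P := blockDynamics k M.gibbs B
  let D := outerBoundary M.graph S
  set Q := censored k M.gibbs B S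
  have hP : IsMonotoneKernel M.gibbs P :=
    blockDynamics_isMonotoneKernel M.gibbs_pos (M.gibbs_mul_le hM) hr B k
  have hQ : IsMonotoneKernel M.gibbs Q :=
    blockDynamics_isMonotoneKernel M.gibbs_pos (M.gibbs_mul_le hM) hr _ k
  have hcorr : CorrLE M.gibbs P Q := blockDynamics_corrLE M.gibbs_pos (M.gibbs_mul_le hM) B k S
  have hδ0 : 0 ≤ δ := le_trans (by positivity) hδ
  have hp0 : 0 ≤ p := (hf.gap_nonneg t v).trans (hp v)
  -- The left factor acts first, so the first `t` steps stay uncensored; the burn-in bound and the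
  -- grand coupling of `P` apply to them.
  have h1 : gap P (t + Tloc * n) v ≤
      (P ^ t * Q ^ (Tloc * n)).mulVec (spin v) ⊤ - (P ^ t * Q ^ (Tloc * n)).mulVec (spin v) ⊥ := by
    rw [gap, pow_add]
    exact CorrLE.gap_le M.gibbs_pos ((hP.pow _).mul (hP.pow _)) ((hP.pow _).mul (hQ.pow _))
      (CorrLE.mul (hP.pow _) (hQ.pow _) (CorrLE.refl _) (CorrLE.pow hP hQ hcorr _))
      (spin_nonneg v) (spin_monotone v)
  refine h1.trans ?_
  simp only [← Matrix.mulVec_mulVec]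
  set F := (Q ^ (Tloc * n)).mulVec (spin v)
  rw [← hf.integral_chain, ← hf.integral_chain, ← integral_sub
    (hf.integrable_chain ⊤ ⊤ t fun x _ => F x) (hf.integrable_chain ⊥ ⊥ t fun x _ => F x)]
  have hI : ∀ (c : ℝ) (u : V), Integrable
      (fun ω => c * (if chain f ⊤ ω t u ≠ chain f ⊥ ω t u then 1 else 0 : ℝ)) (seqLaw V) :=
    fun c u => (hf.integrable_chain ⊤ ⊥ t fun a b => if a u ≠ b u then 1 else 0).const_mul c
  have hIbad := hf.integrable_chain ⊤ ⊥ t fun a b =>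
    if D.restrict a ∉ Good ∨ D.restrict b ∉ Good then 1 else 0
  have hI1 := integrable_finsetSum (S ∪ D) fun u _ => hI (2 * δ) u
  have hI2 := integrable_finsetSum univ fun (u : D) _ => hI (influence M.gibbs v D Good u) u
  have hbad : ∫ ω, (if D.restrict (chain f ⊤ ω t) ∉ Good ∨ D.restrict (chain f ⊥ ω t) ∉ Good
      then 1 else 0 : ℝ) ∂seqLaw V ≤ b := by
    have hms : MeasurableSet {ω | D.restrict (chain f ⊤ ω t) ∉ Good ∨
        D.restrict (chain f ⊥ ω t) ∉ Good} :=
      ((hf.measurable_chain ⊤ t).prodMk (hf.measurable_chain ⊥ t))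
        (Set.toFinite {p : Config V × Config V |
          D.restrict p.1 ∉ Good ∨ D.restrict p.2 ∉ Good}).measurableSet
    refine le_trans (le_of_eq ?_) hb
    rw [← integral_indicator_one hms]
    exact integral_congr_ae (Filter.Eventually.of_forall fun ω => by simp [Set.indicator_apply])
  have hgap : ∀ c u, 0 ≤ c →
      ∫ ω, c * (if chain f ⊤ ω t u ≠ chain f ⊥ ω t u then 1 else 0 : ℝ) ∂seqLaw V ≤ c * p := by
    intro c u hc
    rw [integral_const_mul, hf.integral_ne_eq]
    exact mul_le_mul_of_nonneg_left (hp u) hc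
  calc _ ≤ _ := integral_mono
        ((hf.integrable_chain ⊤ ⊤ t fun x _ => F x).sub (hf.integrable_chain ⊥ ⊥ t fun x _ => F x))
        (hIbad.add (hI1.add hI2))
        fun ω => hG.censored_spin_sub_le hr n hδ (chain f ⊤ ω t) (chain f ⊥ ω t)
    _ = _ := (integral_add hIbad (hI1.add hI2)).trans
        (congrArg₂ _ rfl ((integral_add hI1 hI2).trans (congrArg₂ _
          (integral_finsetSum _ fun u _ => hI _ _) (integral_finsetSum _ fun u _ => hI _ _))))
    _ ≤ b + (∑ u ∈ S ∪ D, 2 * δ * p + ∑ u : D, influence M.gibbs v D Good u * p) :=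
        add_le_add hbad (add_le_add (sum_le_sum fun u _ => hgap _ _ (by positivity))
          (sum_le_sum fun u _ => hgap _ _ (influence_nonneg _ _ _ _ _)))
    _ ≤ b + (∑ u ∈ S ∪ D, 2 * δ * p + 1 / 20 * p) := by
        rw [← sum_mul univ]
        exact add_le_add le_rfl (add_le_add le_rfl (mul_le_mul_of_nonneg_right hG.assm hp0))
    _ = _ := by
        rw [sum_const, nsmul_eq_mul]
        ring

end Gap

lemma two_mul_inv_four_exp_pow_le (n : ℕ) :
    (2 * (1 / (4 * Real.exp 1))) ^ n ≤ Real.exp (-n) := by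
  have h : 2 * (1 / (4 * Real.exp 1)) ≤ Real.exp (-1) := by
    rw [Real.exp_neg, ← one_div, mul_one_div, div_le_div_iff₀ (by positivity) (by positivity)]
    nlinarith [Real.exp_pos 1]
  calc _ ≤ Real.exp (-1) ^ n := pow_le_pow_left₀ (by positivity) h n
    _ = _ := by
      rw [← Real.exp_nat_mul]
      congr 1
      ring

end TwoSpin

/-! ### Choice of the number of rounds and the final estimate. -/

theorem mainTheorem6 :
    ∃ C : ℝ, 0 < C ∧
      ∀ (V : Type*) [Fintype V] [DecidableEq V]
        (M : TwoSpin.System V) (_ : M.Ferromagnetic)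
        (k : TwoSpin.Rule) (r : ℕ) (B : Fin r → Finset V) (_ : ∀ v, ∃ i, v ∈ B i)
        (f : TwoSpin.Config V → TwoSpin.Cube V → TwoSpin.Config V)
        (_ : TwoSpin.IsMonotoneCoupling (TwoSpin.blockDynamics k M.gibbs B) f)
        (Tloc Tburn : ℕ) (_ : 0 < Tloc) (_ : 0 < Tburn)
        (S : V → Finset V)
        (Good : (v : V) → Set (TwoSpin.outerBoundary M.graph (S v) → Bool))
        (_ : ∃ v, 2 ≤ (S v ∪ TwoSpin.outerBoundary M.graph (S v)).card)
        (_ : ∀ v, TwoSpin.IsGood M k B v (S v) (Good v) Tloc)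
        (_ : ∀ v, ∀ t ≥ Tburn,
          (TwoSpin.seqLaw V).real
            {ω | (TwoSpin.outerBoundary M.graph (S v)).restrict
                    (TwoSpin.chain f (fun _ => true) ω t) ∉ Good v ∨
                 (TwoSpin.outerBoundary M.graph (S v)).restrict
                    (TwoSpin.chain f (fun _ => false) ω t) ∉ Good v}
            ≤ 1 / (Fintype.card V : ℝ) ^ 3),
        ∃ T : ℕ,
          TwoSpin.mixingTime (TwoSpin.blockDynamics k M.gibbs B) M.gibbs Set.univ
            (1 / (4 * Real.exp 1)) = T ∧
          (T : ℝ) ≤ C * (Tburn + Tloc *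
            (⨆ v, Real.log ((S v ∪ TwoSpin.outerBoundary M.graph (S v)).card : ℝ)) *
            Real.log (Fintype.card V : ℝ)) := by
  -- `162 = 3 * 6 * 9`: three periods, `J ≤ 6 log n` rounds, and `K ≤ 9 L` local mixing times per
  -- round.
  refine ⟨162, by norm_num, ?_⟩
  intro V _ _ M hM k r B hB f hf Tloc Tburn _ _ S Good hR hG hburn
  obtain ⟨v₀, hv₀⟩ := hR
  have hr : 0 < r := by
    obtain ⟨i, -⟩ := hB v₀
    exact i.pos
  set n : ℝ := (Fintype.card V : ℝ) with hn
  set L : ℝ := ⨆ v, Real.log ((S v ∪ TwoSpin.outerBoundary M.graph (S v)).card : ℝ)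
  set P := TwoSpin.blockDynamics k M.gibbs B
  have hn2 : 2 ≤ n := by
    rw [hn]
    exact_mod_cast hv₀.trans (card_le_univ _)
  have hlogL : ∀ v, Real.log ((S v ∪ TwoSpin.outerBoundary M.graph (S v)).card : ℝ) ≤ L :=
    le_ciSup (f := fun v => Real.log ((S v ∪ TwoSpin.outerBoundary M.graph (S v)).card : ℝ))
      (Set.finite_range _).bddAbove
  have hlog2 := Real.log_two_gt_d9
  -- As `log 2 > 1 / 2`, this lower bound and the one for `log n` absorb the `+ 1` of the ceilings
  -- below.
  have hL2 : Real.log 2 ≤ L :=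
    (Real.log_le_log (by norm_num) (by exact_mod_cast hv₀)).trans (hlogL v₀)
  have hlogn : Real.log 2 ≤ Real.log n := Real.log_le_log (by norm_num) hn2
  have hcard : ∀ v, ((S v ∪ TwoSpin.outerBoundary M.graph (S v)).card : ℝ) ≤ Real.exp L := by
    intro v
    have hpos : (0 : ℝ) < (S v ∪ TwoSpin.outerBoundary M.graph (S v)).card := by
      exact_mod_cast card_pos.2 ⟨v, mem_union_left _ (hG v).mem⟩
    rw [← Real.exp_log hpos]
    exact Real.exp_le_exp.2 (hlogL v)
  -- Of the exponent `7 L`, one `L` cancels `|R|` and `6 L` leaves at most `2⁻⁶`, so the local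
  -- mixing term is at most `2 / 64 ≤ 1 / 20`. The exponent `4 log n` makes the initial error decay
  -- to `n⁻⁴`.
  set K := ⌈7 * L⌉₊
  set J := ⌈4 * Real.log n⌉₊
  have hKle : (K : ℝ) ≤ 9 * L := by
    have := Nat.ceil_lt_add_one (a := 7 * L) (by linarith)
    linarith
  have hJle : (J : ℝ) ≤ 6 * Real.log n := by
    have := Nat.ceil_lt_add_one (a := 4 * Real.log n) (by linarith)
    linarith
  have hδ : (2 * (1 / (4 * Real.exp 1))) ^ K ≤ Real.exp (-(7 * L)) :=
    (TwoSpin.two_mul_inv_four_exp_pow_le K).trans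
      (Real.exp_le_exp.2 (neg_le_neg (Nat.le_ceil _)))
  have hsmall : ∀ v, 2 * Real.exp (-(7 * L)) *
      ((S v ∪ TwoSpin.outerBoundary M.graph (S v)).card : ℝ) ≤ 1 / 20 := by
    intro v
    have h6 : Real.exp (-(6 * L)) ≤ 1 / 64 := by
      calc Real.exp (-(6 * L)) ≤ Real.exp (-(6 * Real.log 2)) :=
            Real.exp_le_exp.2 (by linarith)
        _ = 1 / 64 := by
            rw [Real.exp_neg, show 6 * Real.log 2 = Real.log (2 ^ 6) by
              rw [Real.log_pow]
              norm_num, Real.exp_log (by norm_num)]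
            norm_num
    calc _ ≤ 2 * Real.exp (-(7 * L)) * Real.exp L :=
          mul_le_mul_of_nonneg_left (hcard v) (by positivity)
      _ = 2 * Real.exp (-(6 * L)) := by
          rw [mul_assoc, ← Real.exp_add]
          ring_nf
      _ ≤ 1 / 20 := by linarith
  -- The factor `10 / 9` is the fixed point of `c = 1 + c / 10`: the burn-in errors of all rounds
  -- add up to a geometric series.
  have hrec : ∀ j v, TwoSpin.gap P (Tburn + j * (Tloc * K)) v
      ≤ (1 / 10) ^ j + 10 / 9 * (1 / n ^ 3) := by
    intro j
    induction j with
    | zero =>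
      intro v
      have : 0 ≤ 10 / 9 * (1 / n ^ 3) := by positivity
      linarith [hf.gap_le_one (Tburn + 0 * (Tloc * K)) v, pow_zero (1 / 10 : ℝ)]
    | succ j ih =>
      intro v
      have h1 := (hG v).gap_add_le hM hr hf (Tburn + j * (Tloc * K)) K hδ
        (hburn v _ (Nat.le_add_right _ _)) ih
      rw [show Tburn + (j + 1) * (Tloc * K) = Tburn + j * (Tloc * K) + Tloc * K by ring]
      have h2 : (2 * Real.exp (-(7 * L)) *
          ((S v ∪ TwoSpin.outerBoundary M.graph (S v)).card : ℝ) + 1 / 20) *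
          ((1 / 10) ^ j + 10 / 9 * (1 / n ^ 3)) ≤ 1 / 10 * ((1 / 10) ^ j + 10 / 9 * (1 / n ^ 3)) :=
        mul_le_mul_of_nonneg_right (by linarith [hsmall v]) (by positivity)
      rw [pow_succ]
      linarith
  set t := Tburn + J * (Tloc * K) with ht
  have hP := TwoSpin.blockDynamics_isMonotoneKernel M.gibbs_pos (M.gibbs_mul_le hM) hr B k
  have hJpow : (1 / 10 : ℝ) ^ J ≤ 1 / n ^ 4 := by
    have h10 : (1 / 10 : ℝ) ≤ Real.exp (-1) := by
      rw [Real.exp_neg, ← one_div]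
      exact one_div_le_one_div_of_le (Real.exp_pos 1) (by linarith [Real.exp_one_lt_d9])
    calc (1 / 10 : ℝ) ^ J ≤ Real.exp (-1) ^ J := pow_le_pow_left₀ (by norm_num) h10 J
      _ = Real.exp (-J) := by
          rw [← Real.exp_nat_mul]
          ring_nf
      _ ≤ Real.exp (-(4 * Real.log n)) := Real.exp_le_exp.2 (neg_le_neg (Nat.le_ceil _))
      _ = 1 / n ^ 4 := by
          rw [Real.exp_neg, show 4 * Real.log n = Real.log (n ^ 4) by
            rw [Real.log_pow]
            norm_num, Real.exp_log (by positivity), one_div]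
  -- At `n = 2` the bound is `1 / 8 + 5 / 18 < 0.41`. This is not below `1 / (4 e)`, but its cube
  -- is, hence the time `3 t`.
  have htv : ∀ x y, TwoSpin.tv ((P ^ t) x) ((P ^ t) y) ≤ 41 / 100 := by
    intro x y
    calc _ ≤ ∑ v, TwoSpin.gap P t v := hf.tv_pow_le_sum x y t
      _ ≤ ∑ _v : V, (1 / n ^ 4 + 10 / 9 * (1 / n ^ 3)) :=
          sum_le_sum fun v _ => (hrec J v).trans (by linarith)
      _ = 1 / n ^ 3 + 10 / 9 * (1 / n ^ 2) := by
          rw [sum_const, card_univ, nsmul_eq_mul, ← hn]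
          field_simp
      _ ≤ 1 / 2 ^ 3 + 10 / 9 * (1 / 2 ^ 2) := by gcongr
      _ ≤ 41 / 100 := by norm_num
  have hmix : TwoSpin.mixingTime P M.gibbs Set.univ (1 / (4 * Real.exp 1)) ≤ (t * 3 : ℕ) := by
    refine TwoSpin.mixingTime_le fun x _ => ?_
    rw [pow_mul]
    refine (TwoSpin.tv_pow_le (hP.pow t).sum_row (fun x => (M.gibbs_pos x).le) M.sum_gibbs
      (hP.pow t).stationary htv 3 x).trans_lt ?_
    rw [lt_div_iff₀ (by positivity)]
    nlinarith [Real.exp_one_lt_d9]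
  obtain ⟨T, hT⟩ := ENat.ne_top_iff_exists.1 (ne_top_of_le_ne_top (ENat.natCast_ne_top _) hmix)
  refine ⟨T, hT.symm, ?_⟩
  rw [← hT] at hmix
  have hTt : (T : ℝ) ≤ (t * 3 : ℕ) := by exact_mod_cast hmix
  refine hTt.trans ?_
  push_cast [ht]
  have hJK : (J : ℝ) * K ≤ 6 * Real.log n * (9 * L) :=
    mul_le_mul hJle hKle (by positivity) (by linarith)
  have := mul_le_mul_of_nonneg_left hJK (Nat.cast_nonneg (α := ℝ) Tloc)
  nlinarith [Nat.cast_nonneg (α := ℝ) Tburn]
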